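/- A *cell* is a unit square $[x,x+1]\times[y,y+1]$ with $x,y\in\mathbb Z$. A *polyomino* is a nonempty finite set of cells that is connected through common edges; it has *no holes* if the set of the remaining cells is connected through common edges too; it is *convex* if each of its rows and each of its columns is connected. The boundary of a polyomino without holes is run through clockwise, starting from the lowest leftmost vertex, and is coded by a cyclic word in the unit steps $N,E,S,W$. Let $A_1,A_2,\dots$ be its vertices (the corners of the boundary) in this order. For $n\ge 2$, a *permutomino of size $n$* is a polyomino without holes with $n-1$ rows and $n-1$ columns, placed so that the south-west corner of its minimal bounding rectangle is $(1,1)$, such that $\{A_1,A_3,\dots\}$ and $\{A_2,A_4,\dots\}$ are each of the form $\{(i,\pi(i)):1\le i\le n\}$ for a permutation $\pi$ of $\{1,\dots,n\}$. A *reentrant point* of type $\alpha$, $\beta$, $\gamma$, $\delta$ is a point where the boundary word has $EN$, $SE$, $WS$, $NW$, respectively. **Proposition.** Let $n\ge 2$. Sending a convex permutomino $P$ of size $n$ to the array of its reentrant points, each labelled by its type, is a bijection from the set of convex permutominoes of size $n$ onto the set of permutation matrices of dimension $n-2$ (rows and columns indexed by the coordinates $2,\dots,n-1$, exactly one symbol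 in each row and in each column, the other entries empty) in the symbols $\alpha,\beta,\gamma,\delta$ that satisfy the following conditions, where $x$ and $y$ denote the abscissa and the ordinate of a point: 1. $x_A<x_B$ for every $\alpha$-point $A$ and $\beta$-point $B$; $x_D<x_C$ for every $\delta$-point $D$ and $\gamma$-point $C$; $y_A>y_D$ for every $\alpha$-point $A$ and $\delta$-point $D$; $y_B>y_C$ for every $\beta$-point $B$ and $\gamma$-point $C$; 2. $\neg(x_A>x_C\wedge y_A<y_C)$ for every $\alpha$-point $A$ and $\gamma$-point $C$; $\neg(x_B<x_D\wedge y_B<y_D)$ for every $\beta$-point $B$ and $\delta$-point $D$; 3. the ordinates of the $\alpha$-points are strictly increasing from left to right, and so are those of the $\gamma$-points; the ordinates of the $\beta$-points are strictly decreasing from left to right, and so are those of the $\delta$-points. In particular, all reentrant points of $P$ have both coordinates in $\{2,\dots,n-1\}$, their labelled matrix is a permutation matrix satisfying 1–3, and each labelled permutation matrix of dimension $n-2$ satisfying 1–3 is the matrix of exactly one convex permutomino of size $n$. -/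

import Mathlib

namespace Permutomino

/-- The cell `(x, y)` is the unit square `[x, x+1] × [y, y+1]`; two cells are adjacent when they
share an edge. -/
def cellGraph : SimpleGraph (ℤ × ℤ) where
  Adj a b := (a.1 = b.1 ∧ |a.2 - b.2| = 1) ∨ (a.2 = b.2 ∧ |a.1 - b.1| = 1)
  symm := ⟨fun a b h => by
    rcases h with ⟨h1, h2⟩ | ⟨h1, h2⟩
    · exact Or.inl ⟨h1.symm, by rw [abs_sub_comm]; exact h2⟩
    · exact Or.inr ⟨h1.symm, by rw [abs_sub_comm]; exact h2⟩⟩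
  loopless := ⟨fun a h => by simp at h⟩

/-- A polyomino: a nonempty finite set of cells, connected through shared edges. -/
def IsPolyomino (P : Finset (ℤ × ℤ)) : Prop :=
  (cellGraph.induce (P : Set (ℤ × ℤ))).Connected

/-- No holes: the cells outside `P` are connected through shared edges. -/
def HasNoHoles (P : Finset (ℤ × ℤ)) : Prop :=
  (cellGraph.induce ((P : Set (ℤ × ℤ))ᶜ)).Preconnected

/-- Every row is connected. -/
def IsRowConvex (P : Finset (ℤ × ℤ)) : Prop :=
  ∀ a b c y : ℤ, a ≤ b → b ≤ c → (a, y) ∈ P → (c, y) ∈ P → (b, y) ∈ P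

/-- Every column is connected. -/
def IsColumnConvex (P : Finset (ℤ × ℤ)) : Prop :=
  ∀ x a b c : ℤ, a ≤ b → b ≤ c → (x, a) ∈ P → (x, c) ∈ P → (x, b) ∈ P

/-- Unit steps: north, east, south, west. -/
inductive Step
  | N | E | S | W

/-- The displacement of a unit step. -/
def Step.vec : Step → ℤ × ℤ
  | .N => (0, 1)
  | .E => (1, 0)
  | .S => (0, -1)
  | .W => (-1, 0)

/-- The cell on the right-hand side of a unit step starting at the lattice point `v`. -/
def rightCell (v : ℤ × ℤ) : Step → ℤ × ℤ
  | .N => (v.1, v.2)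
  | .E => (v.1, v.2 - 1)
  | .S => (v.1 - 1, v.2 - 1)
  | .W => (v.1 - 1, v.2)

/-- The cell on the left-hand side of a unit step starting at the lattice point `v`. -/
def leftCell (v : ℤ × ℤ) : Step → ℤ × ℤ
  | .N => (v.1 - 1, v.2)
  | .E => (v.1, v.2)
  | .S => (v.1, v.2 - 1)
  | .W => (v.1 - 1, v.2 - 1)

/-- The boundary of `P`, run through clockwise (interior on the right), contains the unit step `d`
starting at the lattice point `v`. -/
def IsBoundaryStep (P : Finset (ℤ × ℤ)) (v : ℤ × ℤ) (d : Step) : Prop :=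
  rightCell v d ∈ P ∧ leftCell v d ∉ P

/-- The clockwise boundary of `P` arrives at the lattice point `v` by a step `d` and leaves it by a
step `e`: the sequence `d e` occurs at `v` in the cyclic boundary word.
(The boundary of a polyomino without holes is a simple closed curve, so that each lattice point is
passed at most once.) -/
def BoundaryPasses (P : Finset (ℤ × ℤ)) (v : ℤ × ℤ) (d e : Step) : Prop :=
  IsBoundaryStep P (v - d.vec) d ∧ IsBoundaryStep P v e

/-- The vertices `A₁, A₃, A₅, …` of the clockwise list of vertices that starts at the lowest
leftmost vertex. That vertex is left by a north step, and horizontal and vertical sides alternate;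
hence they are the corners at which the boundary arrives horizontally and leaves vertically. -/
def oddVertices (P : Finset (ℤ × ℤ)) : Set (ℤ × ℤ) :=
  {v | BoundaryPasses P v .E .N ∨ BoundaryPasses P v .E .S ∨
       BoundaryPasses P v .W .N ∨ BoundaryPasses P v .W .S}

/-- The vertices `A₂, A₄, A₆, …` of the same list: the corners at which the boundary arrives
vertically and leaves horizontally. -/
def evenVertices (P : Finset (ℤ × ℤ)) : Set (ℤ × ℤ) :=
  {v | BoundaryPasses P v .N .E ∨ BoundaryPasses P v .N .W ∨
       BoundaryPasses P v .S .E ∨ BoundaryPasses P v .S .W}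

/-- The points of `S` are the points `(i, π i)`, `1 ≤ i ≤ n`, of a permutation `π` of
`{1, …, n}`. -/
def RepresentsPerm (n : ℕ) (S : Set (ℤ × ℤ)) : Prop :=
  ∃ π : Equiv.Perm (Fin n), S = Set.range fun i : Fin n => ((i : ℤ) + 1, (π i : ℤ) + 1)

/-- A permutomino of size `n` (`n ≥ 2`): a polyomino without holes, with `n - 1` rows and `n - 1`
columns, whose minimal bounding rectangle has its south-west corner at `(1, 1)`, such that the
vertices `A₁, A₃, …` and the vertices `A₂, A₄, …` represent permutations of `{1, …, n}`. -/
structure IsPermutomino (n : ℕ) (P : Finset (ℤ × ℤ)) : Prop where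
  polyomino : IsPolyomino P
  noHoles : HasNoHoles P
  columns : P.image Prod.fst = Finset.Icc 1 ((n : ℤ) - 1)
  rows : P.image Prod.snd = Finset.Icc 1 ((n : ℤ) - 1)
  perm₁ : RepresentsPerm n (oddVertices P)
  perm₂ : RepresentsPerm n (evenVertices P)

/-- A convex permutomino of size `n`. -/
structure IsConvexPermutomino (n : ℕ) (P : Finset (ℤ × ℤ)) : Prop extends IsPermutomino n P where
  rowConvex : IsRowConvex P
  columnConvex : IsColumnConvex P

/-- The four symbols `α`, `β`, `γ`, `δ`. -/
inductive Symb
  | α | β | γ | δ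

/-- `v` is a reentrant point of `P` of the given type: the boundary word has `EN`, `SE`, `WS`, `NW`
at `v` for the types `α`, `β`, `γ`, `δ`, respectively. -/
def IsReentrant (P : Finset (ℤ × ℤ)) : Symb → ℤ × ℤ → Prop
  | .α, v => BoundaryPasses P v .E .N
  | .β, v => BoundaryPasses P v .S .E
  | .γ, v => BoundaryPasses P v .W .S
  | .δ, v => BoundaryPasses P v .N .W

/-- A matrix of dimension `m` whose entries are empty (`none`) or one of the four symbols. The entry
`M y x` sits in the column `x`, counted from the left, and in the row `y`, counted from the
bottom. -/
abbrev SymbMatrix (m : ℕ) : Type := Matrix (Fin m) (Fin m) (Option Symb)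

/-- `M` is a permutation matrix in the symbols `α`, `β`, `γ`, `δ`: each row and each column holds
exactly one symbol. -/
def IsPermMatrix {m : ℕ} (M : SymbMatrix m) : Prop :=
  (∀ y, ∃! x, M y x ≠ none) ∧ (∀ x, ∃! y, M y x ≠ none)

/-- The point with abscissa `x` and ordinate `y` of `M` is of type `t`. -/
def IsPoint {m : ℕ} (M : SymbMatrix m) (t : Symb) (x y : Fin m) : Prop := M y x = some t

/-- `M` is the matrix defined by the reentrant points of a permutomino. As the bounding rectangle
has its south-west corner at `(1, 1)` and holds no reentrant point on its sides, the first row and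
the first column of `M` correspond to the coordinate `2`. In particular, every reentrant point is
recorded in `M`. -/
def IsReentrantMatrix {m : ℕ} (P : Finset (ℤ × ℤ)) (M : SymbMatrix m) : Prop :=
  ∀ (t : Symb) (v : ℤ × ℤ),
    IsReentrant P t v ↔ ∃ x y : Fin m, v = ((x : ℤ) + 2, (y : ℤ) + 2) ∧ IsPoint M t x y

/-- The order conditions on the points of the four types. -/
structure OrderConditions {m : ℕ} (M : SymbMatrix m) : Prop where
  αβ : ∀ xA yA xB yB, IsPoint M .α xA yA → IsPoint M .β xB yB → xA < xB
  δγ : ∀ xD yD xC yC, IsPoint M .δ xD yD → IsPoint M .γ xC yC → xD < xC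
  αδ : ∀ xA yA xD yD, IsPoint M .α xA yA → IsPoint M .δ xD yD → yA > yD
  βγ : ∀ xB yB xC yC, IsPoint M .β xB yB → IsPoint M .γ xC yC → yB > yC
  αγ : ∀ xA yA xC yC, IsPoint M .α xA yA → IsPoint M .γ xC yC → ¬ (xA > xC ∧ yA < yC)
  βδ : ∀ xB yB xD yD, IsPoint M .β xB yB → IsPoint M .δ xD yD → ¬ (xB < xD ∧ yB < yD)
  incr_α : ∀ x y x' y', IsPoint M .α x y → IsPoint M .α x' y' → x < x' → y < y'
  incr_γ : ∀ x y x' y', IsPoint M .γ x y → IsPoint M .γ x' y' → x < x' → y < y'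
  decr_β : ∀ x y x' y', IsPoint M .β x y → IsPoint M .β x' y' → x < x' → y' < y
  decr_δ : ∀ x y x' y', IsPoint M .δ x y → IsPoint M .δ x' y' → x < x' → y' < y

end Permutomino

/-! ### Vertices and reentrant points read off from the four surrounding cells. -/

namespace Permutomino

/-! A cell outside a convex polyomino sees an empty half-row and an empty half-column, and
connectedness then empties the whole quadrant between these two rays
(`IsConvexPermutomino.convexCells`). So the polyomino is its bounding rectangle minus four corner
staircases. A free quadrant, enlarged until cells block it in both directions, ends at a reentrant
point (`exists_α` and its mirror images), so each staircase is the union of the quadrants cut off by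
the reentrant points of one type. This is `ConvexCells.iff_region`; it recovers the polyomino from
its labelled points and gives uniqueness.

Conversely, cut the quadrants of a labelled matrix out of the rectangle. Conditions 1 and 2 keep
quadrants of different types from jointly swallowing a row or column, and consecutive columns even
overlap (`Config.exists_common_row`); condition 3 keeps points of one type from hiding each other.
Hence the region is convex and connected, and its reentrant points are exactly the given ones
(`Config.reentrantAt_region`).

The permutation property is a count on each inner lattice line. If the columns on its two sides are
`[a, b)` and `[c, d)`, a change of the upper end yields one odd vertex, one even vertex and one
reentrant point, and so does a change of the lower end. So one vertex of each parity per line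
amounts to one reentrant point per line (`col_reentrantAt`, `existsUnique_corner_col`).
Transposition gives the horizontal lines. -/

/-- The four reentrant types, expressed by the cells around the lattice point `(x, y)`. -/
def reentrantAt (Q : ℤ → ℤ → Prop) : Symb → ℤ → ℤ → Prop
  | .α, x, y => ¬ Q (x - 1) y ∧ Q (x - 1) (y - 1) ∧ Q x y
  | .β, x, y => ¬ Q x y ∧ Q (x - 1) y ∧ Q x (y - 1)
  | .γ, x, y => ¬ Q x (y - 1) ∧ Q x y ∧ Q (x - 1) (y - 1)
  | .δ, x, y => ¬ Q (x - 1) (y - 1) ∧ Q (x - 1) y ∧ Q x (y - 1)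

/-- The boundary arrives at `(x, y)` horizontally and leaves it vertically. -/
def OddCorner (Q : ℤ → ℤ → Prop) (x y : ℤ) : Prop :=
  (Q (x - 1) (y - 1) ∧ ¬ Q (x - 1) y ∨ Q x y ∧ ¬ Q x (y - 1)) ∧
    (Q x y ∧ ¬ Q (x - 1) y ∨ Q (x - 1) (y - 1) ∧ ¬ Q x (y - 1))

/-- The boundary arrives at `(x, y)` vertically and leaves it horizontally. -/
def EvenCorner (Q : ℤ → ℤ → Prop) (x y : ℤ) : Prop :=
  (Q x (y - 1) ∧ ¬ Q (x - 1) (y - 1) ∨ Q (x - 1) y ∧ ¬ Q x y) ∧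
    (Q x (y - 1) ∧ ¬ Q x y ∨ Q (x - 1) y ∧ ¬ Q (x - 1) (y - 1))

/-- Membership in `P` as a binary predicate. -/
def cells (P : Finset (ℤ × ℤ)) (x y : ℤ) : Prop := (x, y) ∈ P

theorem mem_oddVertices_iff (P : Finset (ℤ × ℤ)) (x y : ℤ) :
    (x, y) ∈ oddVertices P ↔ OddCorner (cells P) x y := by
  simp only [oddVertices, Set.mem_ofPred_eq, BoundaryPasses, IsBoundaryStep, rightCell, leftCell,
    Step.vec, OddCorner, cells, Prod.mk_sub_mk, sub_zero, sub_neg_eq_add, add_sub_cancel_right]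
  tauto

theorem mem_evenVertices_iff (P : Finset (ℤ × ℤ)) (x y : ℤ) :
    (x, y) ∈ evenVertices P ↔ EvenCorner (cells P) x y := by
  simp only [evenVertices, Set.mem_ofPred_eq, BoundaryPasses, IsBoundaryStep, rightCell, leftCell,
    Step.vec, EvenCorner, cells, Prod.mk_sub_mk, sub_zero, sub_neg_eq_add, add_sub_cancel_right]
  tauto

theorem isReentrant_iff (P : Finset (ℤ × ℤ)) (t : Symb) (x y : ℤ) :
    IsReentrant P t (x, y) ↔ reentrantAt (cells P) t x y := by
  cases t <;>
  simp only [IsReentrant, BoundaryPasses, IsBoundaryStep, rightCell, leftCell,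
    Step.vec, reentrantAt, cells, Prod.mk_sub_mk, sub_zero, sub_neg_eq_add,
    add_sub_cancel_right] <;>
  tauto

/-! ### Convex cell sets and the free quadrants at their corners. -/

/-- The order-theoretic properties of a convex polyomino whose minimal bounding rectangle consists
of the cells with coordinates in `{1, …, n - 1}`. -/
structure ConvexCells (n : ℤ) (Q : ℤ → ℤ → Prop) : Prop where
  bound : ∀ x y, Q x y → 1 ≤ x ∧ x ≤ n - 1 ∧ 1 ≤ y ∧ y ≤ n - 1
  row : ∀ a b c y, a ≤ b → b ≤ c → Q a y → Q c y → Q b y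
  col : ∀ x a b c, a ≤ b → b ≤ c → Q x a → Q x c → Q x b
  col_nonempty : ∀ x, 1 ≤ x → x ≤ n - 1 → ∃ y, Q x y
  row_nonempty : ∀ y, 1 ≤ y → y ≤ n - 1 → ∃ x, Q x y
  col_overlap : ∀ x, 2 ≤ x → x ≤ n - 1 → ∃ y, Q (x - 1) y ∧ Q x y
  row_overlap : ∀ y, 2 ≤ y → y ≤ n - 1 → ∃ x, Q x (y - 1) ∧ Q x y
  quadrant : ∀ x y, ¬ Q x y →
    (∀ a b, a ≤ x → y ≤ b → ¬ Q a b) ∨ (∀ a b, x ≤ a → y ≤ b → ¬ Q a b) ∨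
    (∀ a b, x ≤ a → b ≤ y → ¬ Q a b) ∨ (∀ a b, a ≤ x → b ≤ y → ¬ Q a b)

namespace ConvexCells

variable {n : ℤ} {Q : ℤ → ℤ → Prop}

theorem transpose (h : ConvexCells n Q) : ConvexCells n (fun x y => Q y x) where
  bound x y hq := by have := h.bound y x hq; omega
  row a b c y := h.col y a b c
  col x a b c := h.row a b c x
  col_nonempty := h.row_nonempty
  row_nonempty := h.col_nonempty
  col_overlap := h.row_overlap
  row_overlap := h.col_overlap
  quadrant x y hq := by
    rcases h.quadrant y x hq with h1 | h1 | h1 | h1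
    · exact Or.inr (Or.inr (Or.inl fun a b ha hb => h1 b a hb ha))
    · exact Or.inr (Or.inl fun a b ha hb => h1 b a hb ha)
    · exact Or.inl fun a b ha hb => h1 b a hb ha
    · exact Or.inr (Or.inr (Or.inr fun a b ha hb => h1 b a hb ha))

/-- Cells are reflected by `x ↦ n - x`, but vertical lattice lines by `x ↦ n + 1 - x`, because the
left edge of a cell becomes a right edge. This explains the `n + 1 - a` in `exists_β` and
`exists_δ`. -/
theorem reflect (h : ConvexCells n Q) : ConvexCells n (fun x y => Q (n - x) y) where
  bound x y hq := by have := h.bound _ _ hq; omega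
  row a b c y hab hbc ha hc := h.row (n - c) (n - b) (n - a) y (by omega) (by omega) hc ha
  col x a b c := h.col _ a b c
  col_nonempty x h1 h2 := h.col_nonempty (n - x) (by omega) (by omega)
  row_nonempty y h1 h2 := by
    obtain ⟨x, hx⟩ := h.row_nonempty y h1 h2
    exact ⟨n - x, by simpa using hx⟩
  col_overlap x h1 h2 := by
    obtain ⟨y, hy1, hy2⟩ := h.col_overlap (n - (x - 1)) (by omega) (by omega)
    refine ⟨y, hy2, ?_⟩
    rwa [show n - (x - 1) - 1 = n - x by ring] at hy1
  row_overlap y h1 h2 := by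
    obtain ⟨x, hx1, hx2⟩ := h.row_overlap y h1 h2
    exact ⟨n - x, by simpa using hx1, by simpa using hx2⟩
  quadrant x y hq := by
    rcases h.quadrant _ _ hq with h1 | h1 | h1 | h1
    · exact Or.inr (Or.inl fun a b ha hb => h1 _ b (by omega) hb)
    · exact Or.inl fun a b ha hb => h1 _ b (by omega) hb
    · exact Or.inr (Or.inr (Or.inr fun a b ha hb => h1 _ b (by omega) hb))
    · exact Or.inr (Or.inr (Or.inl fun a b ha hb => h1 _ b (by omega) hb))

/-- The missing cell at the corner has some free quadrant, and its two neighbours at the corner,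
being present, rule out all but the north-west one. -/
theorem quadrant_of_α (h : ConvexCells n Q) {x y : ℤ} (hq : reentrantAt Q .α x y) :
    ∀ a b, a < x → y ≤ b → ¬ Q a b := by
  obtain ⟨h1, h2, h3⟩ := hq
  rcases h.quadrant _ _ h1 with h4 | h4 | h4 | h4
  · exact fun a b ha hb => h4 a b (by omega) hb
  · exact absurd h3 (h4 _ _ (by omega) (by omega))
  · exact absurd h2 (h4 _ _ (by omega) (by omega))
  · exact absurd h2 (h4 _ _ (by omega) (by omega))

theorem quadrant_of_β (h : ConvexCells n Q) {x y : ℤ} (hq : reentrantAt Q .β x y) :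
    ∀ a b, x ≤ a → y ≤ b → ¬ Q a b := by
  obtain ⟨h1, h2, h3⟩ := hq
  rcases h.quadrant _ _ h1 with h4 | h4 | h4 | h4
  · exact absurd h2 (h4 _ _ (by omega) (by omega))
  · exact h4
  · exact absurd h3 (h4 _ _ (by omega) (by omega))
  · exact absurd h2 (h4 _ _ (by omega) (by omega))

theorem quadrant_of_γ (h : ConvexCells n Q) {x y : ℤ} (hq : reentrantAt Q .γ x y) :
    ∀ a b, x ≤ a → b < y → ¬ Q a b := by
  obtain ⟨h1, h2, h3⟩ := hq
  exact fun a b ha hb => h.transpose.quadrant_of_α (x := y) (y := x) ⟨h1, h3, h2⟩ b a hb ha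

theorem quadrant_of_δ (h : ConvexCells n Q) {x y : ℤ} (hq : reentrantAt Q .δ x y) :
    ∀ a b, a < x → b < y → ¬ Q a b := by
  obtain ⟨h1, h2, h3⟩ := hq
  rcases h.quadrant _ _ h1 with h4 | h4 | h4 | h4
  · exact absurd h2 (h4 _ _ (by omega) (by omega))
  · exact absurd h2 (h4 _ _ (by omega) (by omega))
  · exact absurd h3 (h4 _ _ (by omega) (by omega))
  · exact fun a b ha hb => h4 a b (by omega) (by omega)

/-- A cell of the bounding rectangle whose north-west quadrant is free lies to the north-west of a
reentrant point of type `α`. -/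
theorem exists_α (h : ConvexCells n Q) {x y : ℤ} (hx1 : 1 ≤ x) (hx2 : x ≤ n - 1) (hy1 : 1 ≤ y)
    (hy2 : y ≤ n - 1) (hf : ∀ a b, a ≤ x → y ≤ b → ¬ Q a b) :
    ∃ a b, reentrantAt Q .α a b ∧ x < a ∧ b ≤ y := by
  obtain ⟨x0, hx0⟩ := h.row_nonempty y hy1 hy2
  obtain ⟨y0, hy0⟩ := h.col_nonempty x hx1 hx2
  have hx0' : x < x0 := by by_contra hc; exact hf _ _ (by omega) le_rfl hx0
  have hy0' : y0 < y := by by_contra hc; exact hf _ _ le_rfl (by omega) hy0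
  have hx3 := h.bound _ _ hx0
  have hy3 := h.bound _ _ hy0
  -- Enlarge the free quadrant by a column or by a row while it stays free. The cells `x0` and `y0`
  -- keep the new corner inside the rectangle, and `n - x + y` decreases.
  by_cases h1 : ∀ a b, a ≤ x + 1 → y ≤ b → ¬ Q a b
  · obtain ⟨a, b, hab, h2, h3⟩ := exists_α h (by omega) (by omega) hy1 hy2 h1
    exact ⟨a, b, hab, by omega, h3⟩
  by_cases h2 : ∀ a b, a ≤ x → y - 1 ≤ b → ¬ Q a b
  · obtain ⟨a, b, hab, h3, h4⟩ := exists_α h hx1 hx2 (by omega) (by omega) h2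
    exact ⟨a, b, hab, h3, by omega⟩
  push Not at h1 h2
  obtain ⟨a, b, ha, hb, hab⟩ := h1
  obtain ⟨c, d, hc, hd, hcd⟩ := h2
  obtain rfl : a = x + 1 := by by_contra; exact hf a b (by omega) hb hab
  -- Both enlargements are blocked, by a cell in column `x + 1` and one in row `y - 1`. Together
  -- with `x0` and `y0` they meet every quadrant of the two cells that must be present.
  obtain rfl : d = y - 1 := by by_contra; exact hf c d hc (by omega) hcd
  refine ⟨x + 1, y, ⟨?_, ?_, ?_⟩, by omega, le_rfl⟩
  · exact hf _ _ (by omega) le_rfl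
  · rw [add_sub_cancel_right]
    by_contra hq
    rcases h.quadrant _ _ hq with h4 | h4 | h4 | h4
    · exact h4 _ _ hc le_rfl hcd
    · exact h4 _ _ (by omega) (by omega) hab
    · rcases lt_or_ge y0 (y - 1) with h5 | h5
      · exact h4 _ _ le_rfl h5.le hy0
      · exact hq (by rwa [show y - 1 = y0 by omega])
    · exact h4 _ _ hc le_rfl hcd
  · by_contra hq
    rcases h.quadrant _ _ hq with h4 | h4 | h4 | h4
    · exact h4 _ _ le_rfl hb hab
    · exact h4 _ _ le_rfl hb hab
    · exact h4 _ _ (by omega) le_rfl hx0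
    · exact h4 _ _ (by omega) (by omega) hcd
termination_by (n - x + y).toNat
decreasing_by all_goals omega

theorem exists_γ (h : ConvexCells n Q) {x y : ℤ} (hx1 : 1 ≤ x) (hx2 : x ≤ n - 1) (hy1 : 1 ≤ y)
    (hy2 : y ≤ n - 1) (hf : ∀ a b, x ≤ a → b ≤ y → ¬ Q a b) :
    ∃ a b, reentrantAt Q .γ a b ∧ a ≤ x ∧ y < b := by
  obtain ⟨a, b, ⟨h1, h2, h3⟩, h4, h5⟩ :=
    h.transpose.exists_α hy1 hy2 hx1 hx2 fun a b ha hb => hf b a hb ha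
  exact ⟨b, a, ⟨h1, h3, h2⟩, h5, h4⟩

theorem exists_β (h : ConvexCells n Q) {x y : ℤ} (hx1 : 1 ≤ x) (hx2 : x ≤ n - 1) (hy1 : 1 ≤ y)
    (hy2 : y ≤ n - 1) (hf : ∀ a b, x ≤ a → y ≤ b → ¬ Q a b) :
    ∃ a b, reentrantAt Q .β a b ∧ a ≤ x ∧ b ≤ y := by
  obtain ⟨a, b, ⟨h1, h2, h3⟩, h4, h5⟩ :=
    h.reflect.exists_α (x := n - x) (by omega) (by omega) hy1 hy2
      fun a b ha hb => hf (n - a) b (by omega) hb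
  beta_reduce at h1 h2
  rw [show n - (a - 1) = n + 1 - a by ring] at h1 h2
  refine ⟨n + 1 - a, b, ⟨h1, ?_, h2⟩, by omega, h5⟩
  rwa [show n + 1 - a - 1 = n - a by ring]

theorem exists_δ (h : ConvexCells n Q) {x y : ℤ} (hx1 : 1 ≤ x) (hx2 : x ≤ n - 1) (hy1 : 1 ≤ y)
    (hy2 : y ≤ n - 1) (hf : ∀ a b, a ≤ x → b ≤ y → ¬ Q a b) :
    ∃ a b, reentrantAt Q .δ a b ∧ x < a ∧ y < b := by
  obtain ⟨a, b, ⟨h1, h2, h3⟩, h4, h5⟩ :=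
    h.reflect.exists_γ (x := n - x) (by omega) (by omega) hy1 hy2
      fun a b ha hb => hf (n - a) b (by omega) hb
  rw [show n - (a - 1) = n + 1 - a by ring] at h3
  refine ⟨n + 1 - a, b, ⟨?_, ?_, h3⟩, by omega, h5⟩
  · rwa [show n + 1 - a - 1 = n - a by ring]
  · rwa [show n + 1 - a - 1 = n - a by ring]

end ConvexCells

/-! ### Recovering the cells from the reentrant points. -/

/-- The cells of the bounding rectangle outside the quadrants cut off by the labelled points. -/
structure Region (n : ℤ) (T : Symb → ℤ → ℤ → Prop) (x y : ℤ) : Prop where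
  bound : 1 ≤ x ∧ x ≤ n - 1 ∧ 1 ≤ y ∧ y ≤ n - 1
  α : ∀ a b, T .α a b → ¬ (x < a ∧ b ≤ y)
  β : ∀ a b, T .β a b → ¬ (a ≤ x ∧ b ≤ y)
  γ : ∀ a b, T .γ a b → ¬ (a ≤ x ∧ y < b)
  δ : ∀ a b, T .δ a b → ¬ (x < a ∧ y < b)

theorem ConvexCells.iff_region {n : ℤ} {Q : ℤ → ℤ → Prop} (h : ConvexCells n Q) (x y : ℤ) :
    Q x y ↔ Region n (reentrantAt Q) x y := by
  constructor
  · intro hq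
    refine ⟨h.bound x y hq, ?_, ?_, ?_, ?_⟩ <;> rintro a b hab ⟨h1, h2⟩
    · exact h.quadrant_of_α hab x y h1 h2 hq
    · exact h.quadrant_of_β hab x y h1 h2 hq
    · exact h.quadrant_of_γ hab x y h1 h2 hq
    · exact h.quadrant_of_δ hab x y h1 h2 hq
  · rintro ⟨⟨h1, h2, h3, h4⟩, hα, hβ, hγ, hδ⟩
    by_contra hq
    rcases h.quadrant x y hq with h5 | h5 | h5 | h5
    · obtain ⟨a, b, h6, h7⟩ := h.exists_α h1 h2 h3 h4 h5
      exact hα a b h6 h7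
    · obtain ⟨a, b, h6, h7⟩ := h.exists_β h1 h2 h3 h4 h5
      exact hβ a b h6 h7
    · obtain ⟨a, b, h6, h7⟩ := h.exists_γ h1 h2 h3 h4 h5
      exact hγ a b h6 h7
    · obtain ⟨a, b, h6, h7⟩ := h.exists_δ h1 h2 h3 h4 h5
      exact hδ a b h6 h7

/-! ### From convex permutominoes to labelled permutation matrices. -/

/-- The labelled points `T` form a permutation matrix, with coordinates `2, …, n - 1`, that
satisfies the order conditions. -/
structure Config (n : ℤ) (T : Symb → ℤ → ℤ → Prop) : Prop where
  bound : ∀ t x y, T t x y → 2 ≤ x ∧ x ≤ n - 1 ∧ 2 ≤ y ∧ y ≤ n - 1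
  exists_col : ∀ x, 2 ≤ x → x ≤ n - 1 → ∃ t y, T t x y
  exists_row : ∀ y, 2 ≤ y → y ≤ n - 1 → ∃ t x, T t x y
  unique_col : ∀ t t' x y y', T t x y → T t' x y' → t = t' ∧ y = y'
  unique_row : ∀ t t' x x' y, T t x y → T t' x' y → t = t' ∧ x = x'
  αβ : ∀ x y x' y', T .α x y → T .β x' y' → x < x'
  δγ : ∀ x y x' y', T .δ x y → T .γ x' y' → x < x'
  αδ : ∀ x y x' y', T .α x y → T .δ x' y' → y' < y
  βγ : ∀ x y x' y', T .β x y → T .γ x' y' → y' < y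
  αγ : ∀ x y x' y', T .α x y → T .γ x' y' → ¬ (x' < x ∧ y < y')
  βδ : ∀ x y x' y', T .β x y → T .δ x' y' → ¬ (x < x' ∧ y < y')
  incr_α : ∀ x y x' y', T .α x y → T .α x' y' → x < x' → y < y'
  incr_γ : ∀ x y x' y', T .γ x y → T .γ x' y' → x < x' → y < y'
  decr_β : ∀ x y x' y', T .β x y → T .β x' y' → x < x' → y' < y
  decr_δ : ∀ x y x' y', T .δ x y → T .δ x' y' → x < x' → y' < y

/-- The half-open form makes both ends ordinates of lattice points: the lower and the upper edge of
a column of cells. -/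
theorem exists_interval {p : ℤ → Prop} {l u : ℤ} (hb : ∀ y, p y → l ≤ y ∧ y ≤ u)
    (hc : ∀ a b c, a ≤ b → b ≤ c → p a → p c → p b) (hn : ∃ y, p y) :
    ∃ a b, a < b ∧ ∀ y, p y ↔ a ≤ y ∧ y < b := by
  obtain ⟨a, ha, ha'⟩ := Int.exists_least_of_bdd ⟨l, fun y hy => (hb y hy).1⟩ hn
  obtain ⟨b, hb, hb'⟩ := Int.exists_greatest_of_bdd ⟨u, fun y hy => (hb y hy).2⟩ hn
  refine ⟨a, b + 1, by have := ha' b hb; omega, fun y => ⟨fun hy => ⟨ha' y hy, ?_⟩, fun hy => ?_⟩⟩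
  · have := hb' y hy; omega
  · exact hc a y b hy.1 (by omega) ha hb

/-- The reflection in the main diagonal exchanges the types `α` and `γ`. -/
def Symb.swap : Symb → Symb
  | .α => .γ
  | .β => .β
  | .γ => .α
  | .δ => .δ

theorem Symb.swap_swap (t : Symb) : t.swap.swap = t := by cases t <;> rfl

theorem Symb.swap_injective : Function.Injective Symb.swap :=
  Function.LeftInverse.injective Symb.swap_swap

theorem reentrantAt_transpose (Q : ℤ → ℤ → Prop) (t : Symb) (x y : ℤ) :
    reentrantAt (fun x y => Q y x) t x y ↔ reentrantAt Q t.swap y x := by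
  cases t <;> simp only [reentrantAt, Symb.swap] <;> tauto

theorem oddCorner_transpose (Q : ℤ → ℤ → Prop) (x y : ℤ) :
    OddCorner (fun x y => Q y x) x y ↔ OddCorner Q y x := by
  simp only [OddCorner]; tauto

theorem evenCorner_transpose (Q : ℤ → ℤ → Prop) (x y : ℤ) :
    EvenCorner (fun x y => Q y x) x y ↔ EvenCorner Q y x := by
  simp only [EvenCorner]; tauto

namespace ConvexCells

variable {n : ℤ} {Q : ℤ → ℤ → Prop}

theorem exists_col_interval (h : ConvexCells n Q) {x : ℤ} (h1 : 1 ≤ x) (h2 : x ≤ n - 1) :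
    ∃ a b, a < b ∧ ∀ y, Q x y ↔ a ≤ y ∧ y < b :=
  exists_interval (fun y hy => (h.bound x y hy).2.2) (h.col x) (h.col_nonempty x h1 h2)

theorem reentrantAt_bound (h : ConvexCells n Q) {t : Symb} {x y : ℤ} (hq : reentrantAt Q t x y) :
    2 ≤ x ∧ x ≤ n - 1 ∧ 2 ≤ y ∧ y ≤ n - 1 := by
  cases t <;> obtain ⟨-, h2, h3⟩ := hq <;> have := h.bound _ _ h2 <;> have := h.bound _ _ h3 <;>
    omega

theorem oddCorner_bound (h : ConvexCells n Q) {x y : ℤ} (hq : OddCorner Q x y) :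
    1 ≤ x ∧ x ≤ n ∧ 1 ≤ y ∧ y ≤ n := by
  rcases hq.1 with ⟨h2, -⟩ | ⟨h2, -⟩ <;> have := h.bound _ _ h2 <;> omega

theorem evenCorner_bound (h : ConvexCells n Q) {x y : ℤ} (hq : EvenCorner Q x y) :
    1 ≤ x ∧ x ≤ n ∧ 1 ≤ y ∧ y ≤ n := by
  rcases hq.1 with ⟨h2, -⟩ | ⟨h2, -⟩ <;> have := h.bound _ _ h2 <;> omega

/-- On a vertical line with exactly one odd vertex there is exactly one reentrant point. -/
theorem col_reentrantAt (h : ConvexCells n Q) {x : ℤ} (h1 : 2 ≤ x) (h2 : x ≤ n - 1)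
    (ho : ∃! y, OddCorner Q x y) :
    (∃ t y, reentrantAt Q t x y) ∧
      ∀ t t' y y', reentrantAt Q t x y → reentrantAt Q t' x y' → t = t' ∧ y = y' := by
  obtain ⟨a, b, hab, hp⟩ := h.exists_col_interval (x := x - 1) (by omega) (by omega)
  obtain ⟨c, d, hcd, hq⟩ := h.exists_col_interval (x := x) (by omega) (by omega)
  obtain ⟨z, hz1, hz2⟩ := h.col_overlap x h1 h2
  rw [hp] at hz1
  rw [hq] at hz2
  -- A reentrant point sits at the lower of two different upper ends (`α`, `β`) or at the higher of
  -- two different lower ends (`γ`, `δ`).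
  have hα : ∀ y, reentrantAt Q .α x y ↔ y = b ∧ b < d := fun y => by
    simp only [reentrantAt, hp, hq]; omega
  have hβ : ∀ y, reentrantAt Q .β x y ↔ y = d ∧ d < b := fun y => by
    simp only [reentrantAt, hp, hq]; omega
  have hγ : ∀ y, reentrantAt Q .γ x y ↔ y = c ∧ a < c := fun y => by
    simp only [reentrantAt, hp, hq]; omega
  have hδ : ∀ y, reentrantAt Q .δ x y ↔ y = a ∧ c < a := fun y => by
    simp only [reentrantAt, hp, hq]; omega
  have hodd : ∀ y, OddCorner Q x y ↔ (y = b ∧ b ≠ d) ∨ (y = c ∧ a ≠ c) := fun y => by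
    simp only [OddCorner, hp, hq]; omega
  simp only [hodd] at ho
  obtain ⟨y₀, hy₀, huniq⟩ := ho
  -- If both ends changed, `b` and `c` would both be odd vertices; they differ, since the common row
  -- `z` gives `c < b`.
  have hne : ¬ (b ≠ d ∧ a ≠ c) := fun hc => by
    have := huniq b (Or.inl ⟨rfl, hc.1⟩)
    have := huniq c (Or.inr ⟨rfl, hc.2⟩)
    omega
  constructor
  · rcases lt_trichotomy b d with h3 | h3 | h3
    · exact ⟨.α, b, (hα b).2 ⟨rfl, h3⟩⟩
    · rcases lt_trichotomy a c with h4 | h4 | h4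
      · exact ⟨.γ, c, (hγ c).2 ⟨rfl, h4⟩⟩
      · omega
      · exact ⟨.δ, a, (hδ a).2 ⟨rfl, h4⟩⟩
    · exact ⟨.β, d, (hβ d).2 ⟨rfl, h3⟩⟩
  · intro t t' y y' ht ht'
    cases t <;> cases t' <;> simp only [hα, hβ, hγ, hδ] at ht ht' <;>
      first
        | exact ⟨rfl, by omega⟩
        | exact absurd ht' (by omega)

theorem row_reentrantAt (h : ConvexCells n Q) {y : ℤ} (h1 : 2 ≤ y) (h2 : y ≤ n - 1)
    (ho : ∃! x, OddCorner Q x y) :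
    (∃ t x, reentrantAt Q t x y) ∧
      ∀ t t' x x', reentrantAt Q t x y → reentrantAt Q t' x' y → t = t' ∧ x = x' := by
  have := h.transpose.col_reentrantAt h1 h2 (by simpa only [oddCorner_transpose] using ho)
  simp only [reentrantAt_transpose] at this
  obtain ⟨⟨t, x, hx⟩, hu⟩ := this
  refine ⟨⟨_, x, hx⟩, fun t t' x x' hx hx' => ?_⟩
  rw [← t.swap_swap] at hx
  rw [← t'.swap_swap] at hx'
  have := hu _ _ _ _ hx hx'
  exact ⟨Symb.swap_injective this.1, this.2⟩

/-- The reentrant points of a convex permutomino form a permutation matrix that satisfies the order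
conditions. -/
theorem config (h : ConvexCells n Q) (hc : ∀ x, 1 ≤ x → x ≤ n → ∃! y, OddCorner Q x y)
    (hr : ∀ y, 1 ≤ y → y ≤ n → ∃! x, OddCorner Q x y) : Config n (reentrantAt Q) where
  bound t x y hq := h.reentrantAt_bound hq
  exists_col x h1 h2 := (h.col_reentrantAt h1 h2 (hc x (by omega) (by omega))).1
  exists_row y h1 h2 := (h.row_reentrantAt h1 h2 (hr y (by omega) (by omega))).1
  unique_col t t' x y y' hq := by
    have hb := h.reentrantAt_bound hq
    exact (h.col_reentrantAt hb.1 hb.2.1 (hc x (by omega) (by omega))).2 t t' y y' hq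
  unique_row t t' x x' y hq := by
    have hb := h.reentrantAt_bound hq
    exact (h.row_reentrantAt hb.2.2.1 hb.2.2.2 (hr y (by omega) (by omega))).2 t t' x x' hq
  -- When a condition on two different types fails, the two quadrants cover a full line of the
  -- rectangle: the top row here, then the bottom row, the first and the last column, and an
  -- intermediate column for `αγ` and `βδ`.
  αβ x y x' y' hq hq' := by
    have hb := h.reentrantAt_bound hq
    by_contra hlt
    obtain ⟨a, ha⟩ := h.row_nonempty (n - 1) (by omega) le_rfl
    have hb' := h.reentrantAt_bound hq'
    rcases lt_or_ge a x with h1 | h1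
    · exact h.quadrant_of_α hq a _ h1 (by omega) ha
    · exact h.quadrant_of_β hq' a _ (by omega) (by omega) ha
  δγ x y x' y' hq hq' := by
    have hb := h.reentrantAt_bound hq
    by_contra hlt
    obtain ⟨a, ha⟩ := h.row_nonempty 1 le_rfl (by omega)
    have hb' := h.reentrantAt_bound hq'
    rcases lt_or_ge a x with h1 | h1
    · exact h.quadrant_of_δ hq a _ h1 (by omega) ha
    · exact h.quadrant_of_γ hq' a _ (by omega) (by omega) ha
  αδ x y x' y' hq hq' := by
    have hb := h.reentrantAt_bound hq
    by_contra hlt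
    obtain ⟨a, ha⟩ := h.col_nonempty 1 le_rfl (by omega)
    have hb' := h.reentrantAt_bound hq'
    rcases lt_or_ge a y with h1 | h1
    · exact h.quadrant_of_δ hq' _ a (by omega) (by omega) ha
    · exact h.quadrant_of_α hq _ a (by omega) (by omega) ha
  βγ x y x' y' hq hq' := by
    have hb := h.reentrantAt_bound hq
    by_contra hlt
    obtain ⟨a, ha⟩ := h.col_nonempty (n - 1) (by omega) le_rfl
    have hb' := h.reentrantAt_bound hq'
    rcases lt_or_ge a y with h1 | h1
    · exact h.quadrant_of_γ hq' _ a (by omega) (by omega) ha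
    · exact h.quadrant_of_β hq _ a (by omega) (by omega) ha
  αγ x y x' y' hq hq' := by
    have hb' := h.reentrantAt_bound hq'
    rintro ⟨h1, h2⟩
    obtain ⟨a, ha⟩ := h.col_nonempty x' (by omega) (by omega)
    rcases lt_or_ge a y with h3 | h3
    · exact h.quadrant_of_γ hq' _ a le_rfl (by omega) ha
    · exact h.quadrant_of_α hq _ a (by omega) (by omega) ha
  βδ x y x' y' hq hq' := by
    have hb := h.reentrantAt_bound hq
    rintro ⟨h1, h2⟩
    obtain ⟨a, ha⟩ := h.col_nonempty x (by omega) (by omega)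
    rcases lt_or_ge a y with h3 | h3
    · exact h.quadrant_of_δ hq' _ a (by omega) (by omega) ha
    · exact h.quadrant_of_β hq _ a (by omega) (by omega) ha
  -- For two points of one type in the wrong order, a cell required at one corner lies in the
  -- quadrant cut off by the other.
  incr_α x y x' y' hq hq' hlt := by
    by_contra hle
    exact h.quadrant_of_α hq' x y hlt (by omega) hq.2.2
  incr_γ x y x' y' hq hq' hlt := by
    by_contra hle
    exact h.quadrant_of_γ hq (x' - 1) (y' - 1) (by omega) (by omega) hq'.2.2
  decr_β x y x' y' hq hq' hlt := by
    by_contra hle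
    exact h.quadrant_of_β hq (x' - 1) y' (by omega) (by omega) hq'.2.1
  decr_δ x y x' y' hq hq' hlt := by
    by_contra hle
    exact h.quadrant_of_δ hq' x (y - 1) (by omega) (by omega) hq.2.2

end ConvexCells

/-! ### The region of a labelled configuration. -/

theorem region_transpose {n : ℤ} {T : Symb → ℤ → ℤ → Prop} (x y : ℤ) :
    Region n (fun t x y => T t.swap y x) x y ↔ Region n T y x := by
  constructor <;> rintro ⟨h, hα, hβ, hγ, hδ⟩
  · exact ⟨by omega, fun a b hab hc => hγ b a hab hc.symm, fun a b hab hc => hβ b a hab hc.symm,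
      fun a b hab hc => hα b a hab hc.symm, fun a b hab hc => hδ b a hab hc.symm⟩
  · exact ⟨by omega, fun a b hab hc => hγ b a hab hc.symm, fun a b hab hc => hβ b a hab hc.symm,
      fun a b hab hc => hα b a hab hc.symm, fun a b hab hc => hδ b a hab hc.symm⟩

/-- A quadrant open to the west that removes the middle cell removes the left one too; a quadrant
open to the east removes the right one. -/
theorem region_row {n : ℤ} {T : Symb → ℤ → ℤ → Prop} {a b c y : ℤ} (hab : a ≤ b) (hbc : b ≤ c)
    (ha : Region n T a y) (hc : Region n T c y) : Region n T b y where
  bound := by have := ha.bound; have := hc.bound; omega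
  α u v huv hlt := ha.α u v huv (by omega)
  β u v huv hlt := hc.β u v huv (by omega)
  γ u v huv hlt := hc.γ u v huv (by omega)
  δ u v huv hlt := ha.δ u v huv (by omega)

namespace Config

variable {n : ℤ} {T : Symb → ℤ → ℤ → Prop}

theorem transpose (h : Config n T) : Config n (fun t x y => T t.swap y x) where
  bound t x y ht := by have := h.bound _ _ _ ht; omega
  exists_col x h1 h2 := by
    obtain ⟨t, y, ht⟩ := h.exists_row x h1 h2
    exact ⟨t.swap, y, by rwa [t.swap_swap]⟩
  exists_row y h1 h2 := by
    obtain ⟨t, x, ht⟩ := h.exists_col y h1 h2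
    exact ⟨t.swap, x, by rwa [t.swap_swap]⟩
  unique_col t t' x y y' ht ht' := by
    have := h.unique_row _ _ _ _ _ ht ht'
    exact ⟨Symb.swap_injective this.1, this.2⟩
  unique_row t t' x x' y ht ht' := by
    have := h.unique_col _ _ _ _ _ ht ht'
    exact ⟨Symb.swap_injective this.1, this.2⟩
  αβ x y x' y' ht ht' := h.βγ _ _ _ _ ht' ht
  δγ x y x' y' ht ht' := h.αδ _ _ _ _ ht' ht
  αδ x y x' y' ht ht' := h.δγ _ _ _ _ ht' ht
  βγ x y x' y' ht ht' := h.αβ _ _ _ _ ht' ht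
  αγ x y x' y' ht ht' hc := h.αγ _ _ _ _ ht' ht hc.symm
  βδ x y x' y' ht ht' hc := h.βδ _ _ _ _ ht ht' hc.symm
  incr_α x y x' y' ht ht' hlt := by
    by_contra hle
    rcases lt_or_eq_of_le (not_lt.1 hle) with h1 | h1
    · have := h.incr_γ _ _ _ _ ht' ht h1; omega
    · subst h1; have := h.unique_col _ _ _ _ _ ht ht'; omega
  incr_γ x y x' y' ht ht' hlt := by
    by_contra hle
    rcases lt_or_eq_of_le (not_lt.1 hle) with h1 | h1
    · have := h.incr_α _ _ _ _ ht' ht h1; omega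
    · subst h1; have := h.unique_col _ _ _ _ _ ht ht'; omega
  decr_β x y x' y' ht ht' hlt := by
    by_contra hle
    rcases lt_or_eq_of_le (not_lt.1 hle) with h1 | h1
    · have := h.decr_β _ _ _ _ ht ht' h1; omega
    · subst h1; have := h.unique_col _ _ _ _ _ ht ht'; omega
  decr_δ x y x' y' ht ht' hlt := by
    by_contra hle
    rcases lt_or_eq_of_le (not_lt.1 hle) with h1 | h1
    · have := h.decr_δ _ _ _ _ ht ht' h1; omega
    · subst h1; have := h.unique_col _ _ _ _ _ ht ht'; omega

theorem ne_col (h : Config n T) {t t' : Symb} (hne : t ≠ t') {x y x' y' : ℤ} (ht : T t x y)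
    (ht' : T t' x' y') : x ≠ x' := fun hx => by
  subst hx; exact hne (h.unique_col _ _ _ _ _ ht ht').1

theorem ne_row (h : Config n T) {t t' : Symb} (hne : t ≠ t') {x y x' y' : ℤ} (ht : T t x y)
    (ht' : T t' x' y') : y ≠ y' := fun hy => by
  subst hy; exact hne (h.unique_row _ _ _ _ _ ht ht').1

/-- Two equal or consecutive columns of the region have cells in a common row. -/
theorem exists_common_row (h : Config n T) {x x' : ℤ} (h1 : 1 ≤ x) (h2 : x ≤ x') (h3 : x' ≤ x + 1)
    (h4 : x' ≤ n - 1) : ∃ y, Region n T x y ∧ Region n T x' y := by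
  by_cases hn : 2 ≤ n
  swap; · omega
  -- The row is taken as low as the cuts from below allow in both columns: the maximum of `1` and
  -- the ordinates of the `γ`- and `δ`-points whose quadrants meet column `x` or `x'`. It remains to
  -- see that no cut from above reaches it.
  have hub : ∀ l, (l = 1 ∨ (∃ a, T .γ a l ∧ a ≤ x') ∨ ∃ a, T .δ a l ∧ x < a) → l ≤ n - 1 := by
    rintro l (rfl | ⟨a, ha, -⟩ | ⟨a, ha, -⟩)
    · omega
    · have := h.bound _ _ _ ha; omega
    · have := h.bound _ _ _ ha; omega
  obtain ⟨y, hy, hmax⟩ := Int.exists_greatest_of_bdd ⟨n - 1, hub⟩ ⟨1, Or.inl rfl⟩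
  have hy1 := hmax 1 (Or.inl rfl)
  have hy2 := hub y hy
  have hα : ∀ a b, T .α a b → x < a → y < b := by
    intro a b hab hlt
    have hb := h.bound _ _ _ hab
    rcases hy with rfl | ⟨c, hc, hcx⟩ | ⟨c, hc, hcx⟩
    · omega
    -- Here `c ≤ x' ≤ x + 1 ≤ a`. Since points of different types share no line, `c < a` is strict,
    -- and so is the resulting inequality of ordinates.
    · have := h.αγ _ _ _ _ hab hc
      have := h.ne_col (by simp) hab hc
      have := h.ne_row (by simp) hab hc
      omega
    · exact h.αδ _ _ _ _ hab hc
  have hβ : ∀ a b, T .β a b → a ≤ x' → y < b := by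
    intro a b hab hlt
    have hb := h.bound _ _ _ hab
    rcases hy with rfl | ⟨c, hc, hcx⟩ | ⟨c, hc, hcx⟩
    · omega
    · exact h.βγ _ _ _ _ hab hc
    · have := h.βδ _ _ _ _ hab hc
      have := h.ne_col (by simp) hab hc
      have := h.ne_row (by simp) hab hc
      omega
  have hγ : ∀ a b, T .γ a b → a ≤ x' → b ≤ y :=
    fun a b hab hle => hmax b (Or.inr (Or.inl ⟨a, hab, hle⟩))
  have hδ : ∀ a b, T .δ a b → x < a → b ≤ y :=
    fun a b hab hle => hmax b (Or.inr (Or.inr ⟨a, hab, hle⟩))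
  refine ⟨y, ⟨by omega, ?_, ?_, ?_, ?_⟩, ⟨by omega, ?_, ?_, ?_, ?_⟩⟩ <;> rintro a b hab ⟨h5, h6⟩
  · have := hα a b hab (by omega); omega
  · have := hβ a b hab (by omega); omega
  · have := hγ a b hab (by omega); omega
  · have := hδ a b hab (by omega); omega
  · have := hα a b hab (by omega); omega
  · have := hβ a b hab (by omega); omega
  · have := hγ a b hab (by omega); omega
  · have := hδ a b hab (by omega); omega

theorem exists_common_col (h : Config n T) {y y' : ℤ} (h1 : 1 ≤ y) (h2 : y ≤ y') (h3 : y' ≤ y + 1)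
    (h4 : y' ≤ n - 1) : ∃ x, Region n T x y ∧ Region n T x y' := by
  simpa only [region_transpose] using h.transpose.exists_common_row h1 h2 h3 h4

theorem convexCells (h : Config n T) : ConvexCells n (Region n T) where
  bound _ _ hq := hq.bound
  row _ _ _ _ := region_row
  col x a b c hab hbc ha hc := by
    rw [← region_transpose] at ha hc ⊢
    exact region_row hab hbc ha hc
  col_nonempty x h1 h2 := by
    obtain ⟨y, hy, -⟩ := h.exists_common_row h1 le_rfl (by omega) h2
    exact ⟨y, hy⟩
  row_nonempty y h1 h2 := by
    obtain ⟨x, hx, -⟩ := h.exists_common_col h1 le_rfl (by omega) h2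
    exact ⟨x, hx⟩
  col_overlap x h1 h2 := h.exists_common_row (by omega) (by omega) (by omega) h2
  row_overlap y h1 h2 := h.exists_common_col (by omega) (by omega) (by omega) h2
  -- If every quadrant at a cell contained a cell of the region, no cut could remove it: a cut
  -- reaching it swallows its whole quadrant of the same direction.
  quadrant x y hq := by
    by_contra hc
    simp only [not_or, not_forall, not_not] at hc
    obtain ⟨⟨a1, b1, h1, h2, h3⟩, ⟨a2, b2, h4, h5, h6⟩, ⟨a3, b3, h7, h8, h9⟩,
      ⟨a4, b4, h10, h11, h12⟩⟩ := hc
    refine hq ⟨?_, ?_, ?_, ?_, ?_⟩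
    · have := h3.bound; have := h9.bound; omega
    · intro a b hab hlt; exact h3.α a b hab (by omega)
    · intro a b hab hlt; exact h6.β a b hab (by omega)
    · intro a b hab hlt; exact h9.γ a b hab (by omega)
    · intro a b hab hlt; exact h12.δ a b hab (by omega)

theorem reentrantAt_α (h : Config n T) {x y : ℤ} (ht : T .α x y) :
    reentrantAt (Region n T) .α x y := by
  have hb := h.bound _ _ _ ht
  have hα : ∀ a b, T .α a b → (a < x ∧ b < y) ∨ (a = x ∧ b = y) ∨ (x < a ∧ y < b) := by
    intro a b hab
    rcases lt_trichotomy a x with h1 | h1 | h1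
    · have := h.incr_α _ _ _ _ hab ht h1; omega
    · subst h1; have := h.unique_col _ _ _ _ _ ht hab; omega
    · have := h.incr_α _ _ _ _ ht hab h1; omega
  have hγ : ∀ a b, T .γ a b → a ≠ x ∧ b ≠ y ∧ ¬ (a < x ∧ y < b) := fun a b hab =>
    ⟨h.ne_col (by simp) hab ht, h.ne_row (by simp) hab ht, h.αγ _ _ _ _ ht hab⟩
  refine ⟨fun hq => hq.α x y ht (by omega), ⟨by omega, ?_, ?_, ?_, ?_⟩, ⟨by omega, ?_, ?_, ?_, ?_⟩⟩
    <;> intro a b hab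
  · have := hα a b hab; omega
  · have := h.αβ _ _ _ _ ht hab; omega
  · have := hγ a b hab; omega
  · have := h.αδ _ _ _ _ ht hab; omega
  · have := hα a b hab; omega
  · have := h.αβ _ _ _ _ ht hab; omega
  · have := hγ a b hab; omega
  · have := h.αδ _ _ _ _ ht hab; omega

theorem reentrantAt_β (h : Config n T) {x y : ℤ} (ht : T .β x y) :
    reentrantAt (Region n T) .β x y := by
  have hb := h.bound _ _ _ ht
  have hβ : ∀ a b, T .β a b → (a < x ∧ y < b) ∨ (a = x ∧ b = y) ∨ (x < a ∧ b < y) := by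
    intro a b hab
    rcases lt_trichotomy a x with h1 | h1 | h1
    · have := h.decr_β _ _ _ _ hab ht h1; omega
    · subst h1; have := h.unique_col _ _ _ _ _ ht hab; omega
    · have := h.decr_β _ _ _ _ ht hab h1; omega
  have hδ : ∀ a b, T .δ a b → a ≠ x ∧ b ≠ y ∧ ¬ (x < a ∧ y < b) := fun a b hab =>
    ⟨h.ne_col (by simp) hab ht, h.ne_row (by simp) hab ht, h.βδ _ _ _ _ ht hab⟩
  refine ⟨fun hq => hq.β x y ht (by omega), ⟨by omega, ?_, ?_, ?_, ?_⟩, ⟨by omega, ?_, ?_, ?_, ?_⟩⟩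
    <;> intro a b hab
  · have := h.αβ _ _ _ _ hab ht; omega
  · have := hβ a b hab; omega
  · have := h.βγ _ _ _ _ ht hab; omega
  · have := hδ a b hab; omega
  · have := h.αβ _ _ _ _ hab ht; omega
  · have := hβ a b hab; omega
  · have := h.βγ _ _ _ _ ht hab; omega
  · have := hδ a b hab; omega

/-- Needs its own argument: the diagonal reflection, which turns `α` into `γ`, fixes `β` and `δ`. -/
theorem reentrantAt_δ (h : Config n T) {x y : ℤ} (ht : T .δ x y) :
    reentrantAt (Region n T) .δ x y := by
  have hb := h.bound _ _ _ ht
  have hδ : ∀ a b, T .δ a b → (a < x ∧ y < b) ∨ (a = x ∧ b = y) ∨ (x < a ∧ b < y) := by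
    intro a b hab
    rcases lt_trichotomy a x with h1 | h1 | h1
    · have := h.decr_δ _ _ _ _ hab ht h1; omega
    · subst h1; have := h.unique_col _ _ _ _ _ ht hab; omega
    · have := h.decr_δ _ _ _ _ ht hab h1; omega
  have hβ : ∀ a b, T .β a b → a ≠ x ∧ b ≠ y ∧ ¬ (a < x ∧ b < y) := fun a b hab =>
    ⟨h.ne_col (by simp) hab ht, h.ne_row (by simp) hab ht, h.βδ _ _ _ _ hab ht⟩
  refine ⟨fun hq => hq.δ x y ht (by omega), ⟨by omega, ?_, ?_, ?_, ?_⟩, ⟨by omega, ?_, ?_, ?_, ?_⟩⟩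
    <;> intro a b hab
  · have := h.αδ _ _ _ _ hab ht; omega
  · have := hβ a b hab; omega
  · have := h.δγ _ _ _ _ ht hab; omega
  · have := hδ a b hab; omega
  · have := h.αδ _ _ _ _ hab ht; omega
  · have := hβ a b hab; omega
  · have := h.δγ _ _ _ _ ht hab; omega
  · have := hδ a b hab; omega

theorem reentrantAt_region_of (h : Config n T) {t : Symb} {x y : ℤ} (ht : T t x y) :
    reentrantAt (Region n T) t x y := by
  cases t
  · exact h.reentrantAt_α ht
  · exact h.reentrantAt_β ht
  · have := h.transpose.reentrantAt_α (x := y) (y := x) ht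
    simp only [reentrantAt, region_transpose] at this ⊢
    tauto
  · exact h.reentrantAt_δ ht

/-- The missing cell is removed by some labelled point. A quadrant of another type would remove a
present neighbour too, and one of the right type spares both neighbours only if its apex is `(x,
y)`. -/
theorem of_reentrantAt_region (h : Config n T) {t : Symb} {x y : ℤ}
    (hq : reentrantAt (Region n T) t x y) : T t x y := by
  have key : ∀ u v, ¬ Region n T u v → 1 ≤ u → u ≤ n - 1 → 1 ≤ v → v ≤ n - 1 →
      (∃ a b, T .α a b ∧ u < a ∧ b ≤ v) ∨ (∃ a b, T .β a b ∧ a ≤ u ∧ b ≤ v) ∨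
      (∃ a b, T .γ a b ∧ a ≤ u ∧ v < b) ∨ (∃ a b, T .δ a b ∧ u < a ∧ v < b) := by
    intro u v huv h1 h2 h3 h4
    by_contra hc
    simp only [not_or, not_exists, not_and] at hc
    exact huv ⟨by omega, fun a b hab hlt => hc.1 a b hab hlt.1 hlt.2,
      fun a b hab hlt => hc.2.1 a b hab hlt.1 hlt.2,
      fun a b hab hlt => hc.2.2.1 a b hab hlt.1 hlt.2,
      fun a b hab hlt => hc.2.2.2 a b hab hlt.1 hlt.2⟩
  have hb := h.convexCells.reentrantAt_bound hq
  cases t <;> obtain ⟨h1, h2, h3⟩ := hq <;>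
    rcases key _ _ h1 (by omega) (by omega) (by omega) (by omega) with
      ⟨a, b, hab, h4⟩ | ⟨a, b, hab, h4⟩ | ⟨a, b, hab, h4⟩ | ⟨a, b, hab, h4⟩
  · have := h2.α a b hab; have := h3.α a b hab
    obtain ⟨rfl, rfl⟩ : a = x ∧ b = y := by omega
    exact hab
  · have := h3.β a b hab; omega
  · have := h2.γ a b hab; omega
  · have := h2.δ a b hab; omega
  · have := h2.α a b hab; omega
  · have := h2.β a b hab; have := h3.β a b hab
    obtain ⟨rfl, rfl⟩ : a = x ∧ b = y := by omega
    exact hab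
  · have := h3.γ a b hab; omega
  · have := h3.δ a b hab; omega
  · have := h2.α a b hab; omega
  · have := h2.β a b hab; omega
  · have := h2.γ a b hab; have := h3.γ a b hab
    obtain ⟨rfl, rfl⟩ : a = x ∧ b = y := by omega
    exact hab
  · have := h3.δ a b hab; omega
  · have := h2.α a b hab; omega
  · have := h3.β a b hab; omega
  · have := h3.γ a b hab; omega
  · have := h2.δ a b hab; have := h3.δ a b hab
    obtain ⟨rfl, rfl⟩ : a = x ∧ b = y := by omega
    exact hab

theorem reentrantAt_region (h : Config n T) : reentrantAt (Region n T) = T := by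
  funext t x y
  exact propext ⟨h.of_reentrantAt_region, h.reentrantAt_region_of⟩

end Config

/-! ### One vertex of each parity on every lattice line. -/

namespace ConvexCells

variable {n : ℤ} {Q : ℤ → ℤ → Prop}

/-- If the reentrant points form a permutation matrix, then each vertical line that meets the
bounding rectangle contains exactly one vertex of each parity. -/
theorem existsUnique_corner_col (h : ConvexCells n Q) (hn : 2 ≤ n)
    (hc : Config n (reentrantAt Q)) {x : ℤ} (h1 : 1 ≤ x) (h2 : x ≤ n) :
    (∃! y, OddCorner Q x y) ∧ ∃! y, EvenCorner Q x y := by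
  rcases eq_or_lt_of_le h1 with rfl | h1
  · obtain ⟨c, d, hcd, hq⟩ := h.exists_col_interval (x := 1) (by omega) (by omega)
    have hp : ∀ y, ¬ Q (1 - 1) y := fun y hy => by have := h.bound _ _ hy; omega
    have hodd : ∀ y, OddCorner Q 1 y ↔ y = c := fun y => by
      simp only [OddCorner, hp, hq, false_and, not_false_eq_true, and_true, false_or, or_false]
      omega
    have heven : ∀ y, EvenCorner Q 1 y ↔ y = d := fun y => by
      simp only [EvenCorner, hp, hq, false_and, not_false_eq_true, and_true, or_false]
      omega
    simp only [hodd, heven, existsUnique_eq, and_self]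
  obtain ⟨a, b, hab, hp⟩ := h.exists_col_interval (x := x - 1) (by omega) (by omega)
  rcases eq_or_lt_of_le h2 with rfl | h2
  · have hq : ∀ y, ¬ Q x y := fun y hy => by have := h.bound _ _ hy; omega
    have hodd : ∀ y, OddCorner Q x y ↔ y = b := fun y => by
      simp only [OddCorner, hp, hq, false_and, not_false_eq_true, and_true, false_or, or_false]
      omega
    have heven : ∀ y, EvenCorner Q x y ↔ y = a := fun y => by
      simp only [EvenCorner, hp, hq, false_and, not_false_eq_true, and_true, false_or]
      omega
    simp only [hodd, heven, existsUnique_eq, and_self]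
  obtain ⟨c, d, hcd, hq⟩ := h.exists_col_interval (x := x) (by omega) (by omega)
  obtain ⟨z, hz1, hz2⟩ := h.col_overlap x (by omega) (by omega)
  rw [hp] at hz1
  rw [hq] at hz2
  have hα : ∀ y, reentrantAt Q .α x y ↔ y = b ∧ b < d := fun y => by
    simp only [reentrantAt, hp, hq]; omega
  have hβ : ∀ y, reentrantAt Q .β x y ↔ y = d ∧ d < b := fun y => by
    simp only [reentrantAt, hp, hq]; omega
  have hγ : ∀ y, reentrantAt Q .γ x y ↔ y = c ∧ a < c := fun y => by
    simp only [reentrantAt, hp, hq]; omega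
  have hδ : ∀ y, reentrantAt Q .δ x y ↔ y = a ∧ c < a := fun y => by
    simp only [reentrantAt, hp, hq]; omega
  have hodd : ∀ y, OddCorner Q x y ↔ (y = b ∧ b ≠ d) ∨ (y = c ∧ a ≠ c) := fun y => by
    simp only [OddCorner, hp, hq]; omega
  have heven : ∀ y, EvenCorner Q x y ↔ (y = d ∧ b ≠ d) ∨ (y = a ∧ a ≠ c) := fun y => by
    simp only [EvenCorner, hp, hq]; omega
  -- The symbol on this line forces some end to change. If both changed, the upper one would give
  -- `α` or `β` and the lower one `γ` or `δ`: two symbols on one line.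
  have hone : (b ≠ d ∧ a = c) ∨ (b = d ∧ a ≠ c) := by
    obtain ⟨t, y, ht⟩ := hc.exists_col x (by omega) (by omega)
    by_contra hcon
    have hnd : b ≠ d ∧ a ≠ c := by
      cases t <;> simp only [hα, hβ, hγ, hδ] at ht <;> omega
    have hu : ∀ t₁ t₂ y₁ y₂, reentrantAt Q t₁ x y₁ → reentrantAt Q t₂ x y₂ → t₁ = t₂ :=
      fun t₁ t₂ y₁ y₂ h₁ h₂ => (hc.unique_col t₁ t₂ x y₁ y₂ h₁ h₂).1
    rcases lt_or_gt_of_ne hnd.1 with h3 | h3 <;> rcases lt_or_gt_of_ne hnd.2 with h4 | h4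
    · exact absurd (hu _ _ _ _ ((hα b).2 ⟨rfl, h3⟩) ((hγ c).2 ⟨rfl, h4⟩)) (by simp)
    · exact absurd (hu _ _ _ _ ((hα b).2 ⟨rfl, h3⟩) ((hδ a).2 ⟨rfl, h4⟩)) (by simp)
    · exact absurd (hu _ _ _ _ ((hβ d).2 ⟨rfl, h3⟩) ((hγ c).2 ⟨rfl, h4⟩)) (by simp)
    · exact absurd (hu _ _ _ _ ((hβ d).2 ⟨rfl, h3⟩) ((hδ a).2 ⟨rfl, h4⟩)) (by simp)
  simp only [hodd, heven]
  rcases hone with ⟨h3, h4⟩ | ⟨h3, h4⟩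
  · exact ⟨⟨b, by dsimp only; omega, fun y hy => by omega⟩,
      ⟨d, by dsimp only; omega, fun y hy => by omega⟩⟩
  · exact ⟨⟨c, by dsimp only; omega, fun y hy => by omega⟩,
      ⟨a, by dsimp only; omega, fun y hy => by omega⟩⟩

theorem existsUnique_corner_row (h : ConvexCells n Q) (hn : 2 ≤ n)
    (hc : Config n (reentrantAt Q)) {y : ℤ} (h1 : 1 ≤ y) (h2 : y ≤ n) :
    (∃! x, OddCorner Q x y) ∧ ∃! x, EvenCorner Q x y := by
  have hc' : Config n (reentrantAt fun x y => Q y x) := by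
    have : (reentrantAt fun x y => Q y x) = fun t x y => reentrantAt Q t.swap y x := by
      funext t x y
      exact propext (reentrantAt_transpose Q t x y)
    rw [this]
    exact hc.transpose
  simpa only [oddCorner_transpose, evenCorner_transpose] using
    h.transpose.existsUnique_corner_col hn hc' h1 h2

end ConvexCells

/-! ### Connectedness of the cells and of their complement. -/

theorem cellGraph_adj_iff (a b c d : ℤ) :
    cellGraph.Adj (a, b) (c, d) ↔
      (a = c ∧ (d = b + 1 ∨ b = d + 1)) ∨ (b = d ∧ (c = a + 1 ∨ a = c + 1)) := by
  simp only [cellGraph, abs_eq zero_le_one]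
  omega

/-- A connected set of cells that meets both `S` and its complement contains two adjacent cells
separated by `S`. -/
theorem IsPolyomino.exists_adj {P : Finset (ℤ × ℤ)} (h : IsPolyomino P) (S : ℤ → ℤ → Prop)
    {a b c d : ℤ} (hab : cells P a b) (hS : S a b) (hcd : cells P c d) (hS' : ¬ S c d) :
    ∃ u v u' v', cells P u v ∧ cells P u' v' ∧ S u v ∧ ¬ S u' v' ∧
      ((u = u' ∧ (v' = v + 1 ∨ v = v' + 1)) ∨ (v = v' ∧ (u' = u + 1 ∨ u = u' + 1))) := by
  obtain ⟨w⟩ := h.preconnected ⟨(a, b), hab⟩ ⟨(c, d), hcd⟩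
  have key : ∀ p q : (P : Set (ℤ × ℤ)), (cellGraph.induce (P : Set (ℤ × ℤ))).Walk p q →
      S p.1.1 p.1.2 → ¬ S q.1.1 q.1.2 →
      ∃ u v : (P : Set (ℤ × ℤ)), cellGraph.Adj u.1 v.1 ∧ S u.1.1 u.1.2 ∧ ¬ S v.1.1 v.1.2 := by
    intro p q w
    induction w with
    | nil => exact fun h1 h2 => absurd h1 h2
    | @cons p r q hadj w ih =>
      intro h1 h2
      by_cases h3 : S r.1.1 r.1.2
      · exact ih h3 h2
      · exact ⟨p, r, hadj, h1, h3⟩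
  obtain ⟨⟨⟨u, v⟩, hu⟩, ⟨⟨u', v'⟩, hv⟩, hadj, h1, h2⟩ := key _ _ w hS hS'
  exact ⟨u, v, u', v', hu, hv, h1, h2, (cellGraph_adj_iff u v u' v').1 hadj⟩

theorem IsConvexPermutomino.convexCells {n : ℕ} {P : Finset (ℤ × ℤ)}
    (h : IsConvexPermutomino n P) : ConvexCells n (cells P) := by
  have hbound : ∀ x y, cells P x y → 1 ≤ x ∧ x ≤ (n : ℤ) - 1 ∧ 1 ≤ y ∧ y ≤ (n : ℤ) - 1 := by
    intro x y hq
    have h1 := Finset.mem_image_of_mem Prod.fst hq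
    have h2 := Finset.mem_image_of_mem Prod.snd hq
    rw [h.columns, Finset.mem_Icc] at h1
    rw [h.rows, Finset.mem_Icc] at h2
    exact ⟨h1.1, h1.2, h2.1, h2.2⟩
  have hcol : ∀ x, 1 ≤ x → x ≤ (n : ℤ) - 1 → ∃ y, cells P x y := by
    intro x h1 h2
    have h3 := Finset.mem_Icc.2 ⟨h1, h2⟩
    rw [← h.columns, Finset.mem_image] at h3
    obtain ⟨⟨_, y⟩, h4, rfl⟩ := h3
    exact ⟨y, h4⟩
  have hrow : ∀ y, 1 ≤ y → y ≤ (n : ℤ) - 1 → ∃ x, cells P x y := by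
    intro y h1 h2
    have h3 := Finset.mem_Icc.2 ⟨h1, h2⟩
    rw [← h.rows, Finset.mem_image] at h3
    obtain ⟨⟨x, _⟩, h4, rfl⟩ := h3
    exact ⟨x, h4⟩
  refine ⟨hbound, h.rowConvex, h.columnConvex, hcol, hrow, ?_, ?_, ?_⟩
  · intro x h1 h2
    obtain ⟨b, hb⟩ := hcol (x - 1) (by omega) (by omega)
    obtain ⟨d, hd⟩ := hcol x (by omega) h2
    obtain ⟨u, v, u', v', huv, huv', h3, h4, h5⟩ :=
      h.polyomino.exists_adj (fun a _ => a < x) hb (by omega) hd (by omega)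
    obtain ⟨rfl, rfl, rfl⟩ : u = x - 1 ∧ u' = x ∧ v = v' := by omega
    exact ⟨v, huv, huv'⟩
  · intro y h1 h2
    obtain ⟨b, hb⟩ := hrow (y - 1) (by omega) (by omega)
    obtain ⟨d, hd⟩ := hrow y (by omega) h2
    obtain ⟨u, v, u', v', huv, huv', h3, h4, h5⟩ :=
      h.polyomino.exists_adj (fun _ b => b < y) hb (by omega) hd (by omega)
    obtain ⟨rfl, rfl, rfl⟩ : v = y - 1 ∧ v' = y ∧ u = u' := by omega
    exact ⟨u, huv, huv'⟩
  · intro x y hq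
    have hx : (∀ a, a ≤ x → ¬ cells P a y) ∨ ∀ a, x ≤ a → ¬ cells P a y := by
      by_contra hc
      push Not at hc
      obtain ⟨⟨a, h1, h2⟩, c, h3, h4⟩ := hc
      exact hq (h.rowConvex a x c y h1 h3 h2 h4)
    have hy : (∀ b, b ≤ y → ¬ cells P x b) ∨ ∀ b, y ≤ b → ¬ cells P x b := by
      by_contra hc
      push Not at hc
      obtain ⟨⟨a, h1, h2⟩, c, h3, h4⟩ := hc
      exact hq (h.columnConvex x a y c h1 h3 h2 h4)
    by_contra hc
    simp only [not_or, not_forall, not_not] at hc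
    obtain ⟨⟨a1, b1, h1, h2, h3⟩, ⟨a2, b2, h4, h5, h6⟩, ⟨a3, b3, h7, h8, h9⟩,
      ⟨a4, b4, h10, h11, h12⟩⟩ := hc
    have hex : ∀ {a b : ℤ}, cells P a b → (b = y → ¬ cells P a y) ∧ (a = x → ¬ cells P x b) →
      a ≠ x ∧ b ≠ y := by
      rintro a b hab ⟨h1, h2⟩
      exact ⟨fun hh => h2 hh (hh ▸ hab), fun hh => h1 hh (hh ▸ hab)⟩
    -- The two empty rays wall off one quadrant. Were there cells in it and in the opposite one,
    -- connectedness would give a step leaving it, which must start on one of the rays.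
    rcases hx with hx | hx <;> rcases hy with hy | hy
    · obtain ⟨u, v, u', v', huv, huv', h13, h14, h15⟩ :=
        h.polyomino.exists_adj (fun a b => a ≤ x ∧ b ≤ y) h12 ⟨h10, h11⟩ h6 (fun hle => by
          have := hex h6 ⟨fun _ => hx _ hle.1, fun _ => hy _ hle.2⟩; omega)
      have := hex huv ⟨fun _ => hx _ h13.1, fun _ => hy _ h13.2⟩
      omega
    · obtain ⟨u, v, u', v', huv, huv', h13, h14, h15⟩ :=
        h.polyomino.exists_adj (fun a b => a ≤ x ∧ y ≤ b) h3 ⟨h1, h2⟩ h9 (fun hle => by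
          have := hex h9 ⟨fun _ => hx _ hle.1, fun _ => hy _ hle.2⟩; omega)
      have := hex huv ⟨fun _ => hx _ h13.1, fun _ => hy _ h13.2⟩
      omega
    · obtain ⟨u, v, u', v', huv, huv', h13, h14, h15⟩ :=
        h.polyomino.exists_adj (fun a b => x ≤ a ∧ b ≤ y) h9 ⟨h7, h8⟩ h3 (fun hle => by
          have := hex h3 ⟨fun _ => hx _ hle.1, fun _ => hy _ hle.2⟩; omega)
      have := hex huv ⟨fun _ => hx _ h13.1, fun _ => hy _ h13.2⟩
      omega
    · obtain ⟨u, v, u', v', huv, huv', h13, h14, h15⟩ :=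
        h.polyomino.exists_adj (fun a b => x ≤ a ∧ y ≤ b) h6 ⟨h4, h5⟩ h12 (fun hle => by
          have := hex h12 ⟨fun _ => hx _ hle.1, fun _ => hy _ hle.2⟩; omega)
      have := hex huv ⟨fun _ => hx _ h13.1, fun _ => hy _ h13.2⟩
      omega

theorem reachable_row {S : Set (ℤ × ℤ)} {a b y : ℤ} (hab : a ≤ b)
    (h : ∀ t, a ≤ t → t ≤ b → (t, y) ∈ S) :
    (cellGraph.induce S).Reachable ⟨(a, y), h a le_rfl hab⟩ ⟨(b, y), h b hab le_rfl⟩ := by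
  induction b, hab using Int.leInduction with
  | base => exact SimpleGraph.Reachable.refl _
  | succ b hab ih =>
    refine (ih fun t h1 h2 => h t h1 (by omega)).trans (SimpleGraph.Adj.reachable ?_)
    exact (cellGraph_adj_iff b y (b + 1) y).2 (by omega)

theorem reachable_col {S : Set (ℤ × ℤ)} {x a b : ℤ} (hab : a ≤ b)
    (h : ∀ t, a ≤ t → t ≤ b → (x, t) ∈ S) :
    (cellGraph.induce S).Reachable ⟨(x, a), h a le_rfl hab⟩ ⟨(x, b), h b hab le_rfl⟩ := by
  induction b, hab using Int.leInduction with
  | base => exact SimpleGraph.Reachable.refl _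
  | succ b hab ih =>
    refine (ih fun t h1 h2 => h t h1 (by omega)).trans (SimpleGraph.Adj.reachable ?_)
    exact (cellGraph_adj_iff x b x (b + 1)).2 (by omega)

namespace ConvexCells

variable {n : ℤ} {P : Finset (ℤ × ℤ)}

/-- Each column is an interval and consecutive columns share a row, so every cell is reached from
column `1` by induction on the abscissa. -/
theorem isPolyomino (h : ConvexCells n (cells P)) (hn : 2 ≤ n) : IsPolyomino P := by
  have hcol : ∀ x y y' (hy : (x, y) ∈ P) (hy' : (x, y') ∈ P),
      (cellGraph.induce (P : Set (ℤ × ℤ))).Reachable ⟨(x, y), hy⟩ ⟨(x, y'), hy'⟩ := by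
    intro x y y' hy hy'
    rcases le_total y y' with hle | hle
    · exact reachable_col hle fun t h1 h2 => h.col x y t y' h1 h2 hy hy'
    · exact (reachable_col hle fun t h1 h2 => h.col x y' t y h1 h2 hy' hy).symm
  obtain ⟨y₀, hy₀⟩ := h.col_nonempty 1 le_rfl (by omega)
  have key : ∀ x, 1 ≤ x → x ≤ n - 1 → ∀ y (hy : (x, y) ∈ P),
      (cellGraph.induce (P : Set (ℤ × ℤ))).Reachable ⟨(1, y₀), hy₀⟩ ⟨(x, y), hy⟩ := by
    intro x hx
    induction x, hx using Int.leInduction with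
    | base => exact fun _ y hy => hcol 1 y₀ y hy₀ hy
    | succ x hx ih =>
      intro hx' y hy
      obtain ⟨z, hz, hz'⟩ := h.col_overlap (x + 1) (by omega) hx'
      rw [add_sub_cancel_right] at hz
      refine ((ih (by omega) z hz).trans (SimpleGraph.Adj.reachable ?_)).trans
        (hcol (x + 1) z y hz' hy)
      exact (cellGraph_adj_iff x z (x + 1) z).2 (by omega)
  have : Nonempty (P : Set (ℤ × ℤ)) := ⟨⟨(1, y₀), hy₀⟩⟩
  refine ⟨?_⟩
  rintro ⟨⟨x, y⟩, hp⟩ ⟨⟨x', y'⟩, hq⟩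
  have h1 := h.bound x y hp
  have h2 := h.bound x' y' hq
  exact (key x h1.1 h1.2.1 y hp).symm.trans (key x' h2.1 h2.2.1 y' hq)

/-- By row convexity a missing cell can leave the rectangle horizontally, to the left or to the
right; column `0` and row `0` then lead to the origin. -/
theorem hasNoHoles (h : ConvexCells n (cells P)) : HasNoHoles P := by
  have hout : ∀ x y, ¬ (1 ≤ x ∧ x ≤ n - 1 ∧ 1 ≤ y ∧ y ≤ n - 1) → (x, y) ∈ (P : Set (ℤ × ℤ))ᶜ :=
    fun x y hxy hp => hxy (h.bound x y hp)
  set G := cellGraph.induce ((P : Set (ℤ × ℤ))ᶜ) with hG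
  have h0 : ∀ y, G.Reachable ⟨(0, y), hout _ _ (by omega)⟩ ⟨(0, 0), hout _ _ (by omega)⟩ := by
    intro y
    rcases le_total y 0 with hle | hle
    · exact reachable_col hle fun t _ _ => hout _ _ (by omega)
    · exact (reachable_col hle fun t _ _ => hout _ _ (by omega)).symm
  have hbot : ∀ x, G.Reachable ⟨(x, 0), hout _ _ (by omega)⟩ ⟨(0, 0), hout _ _ (by omega)⟩ := by
    intro x
    rcases le_total x 0 with hle | hle
    · exact reachable_row hle fun t _ _ => hout _ _ (by omega)
    · exact (reachable_row hle fun t _ _ => hout _ _ (by omega)).symm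
  have hright : ∀ x y, (hx : n ≤ x) →
      G.Reachable ⟨(x, y), hout _ _ (by omega)⟩ ⟨(0, 0), hout _ _ (by omega)⟩ := by
    intro x y hx
    refine SimpleGraph.Reachable.trans ?_ (hbot x)
    rcases le_total y 0 with hle | hle
    · exact reachable_col hle fun t _ _ => hout _ _ (by omega)
    · exact (reachable_col hle fun t _ _ => hout _ _ (by omega)).symm
  have key : ∀ x y (hp : (x, y) ∈ (P : Set (ℤ × ℤ))ᶜ),
      G.Reachable ⟨(x, y), hp⟩ ⟨(0, 0), hout _ _ (by omega)⟩ := by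
    intro x y hp
    by_cases hl : ∀ a, a ≤ x → ¬ cells P a y
    · refine SimpleGraph.Reachable.trans ?_ (h0 y)
      rcases le_total x 0 with hle | hle
      · exact reachable_row hle fun t _ _ => hout _ _ (by omega)
      · exact (reachable_row hle fun t _ h2 => hl t h2).symm
    · push Not at hl
      obtain ⟨a, ha, hq⟩ := hl
      have hr : ∀ c, x ≤ c → ¬ cells P c y := fun c hc hcq => hp (h.row a x c y ha hc hq hcq)
      refine SimpleGraph.Reachable.trans ?_ (hright (max x n) y (le_max_right _ _))
      exact reachable_row (le_max_left _ _) fun t h1 _ => hr t h1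
  rintro ⟨⟨x, y⟩, hp⟩ ⟨⟨x', y'⟩, hq⟩
  exact (key x y hp).trans (key x' y' hq).symm

end ConvexCells

/-! ### Translation to permutations, matrices and finite sets. -/

theorem representsPerm_iff (n : ℕ) (S : Set (ℤ × ℤ)) :
    RepresentsPerm n S ↔
      (∀ x y, (x, y) ∈ S → 1 ≤ x ∧ x ≤ n ∧ 1 ≤ y ∧ y ≤ n) ∧
      (∀ x : ℤ, 1 ≤ x → x ≤ n → ∃! y, (x, y) ∈ S) ∧
      ∀ y : ℤ, 1 ≤ y → y ≤ n → ∃! x, (x, y) ∈ S := by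
  constructor
  · rintro ⟨π, rfl⟩
    simp only [Set.mem_range, Prod.mk.injEq]
    refine ⟨?_, ?_, ?_⟩
    · rintro x y ⟨i, rfl, rfl⟩
      have := i.2
      have := (π i).2
      omega
    · intro x h1 h2
      have hx : (x - 1).toNat < n := by omega
      refine ⟨(π ⟨_, hx⟩ : ℤ) + 1, ⟨⟨_, hx⟩, by simp only; omega, rfl⟩, ?_⟩
      rintro y ⟨i, hi, rfl⟩
      have : i = ⟨_, hx⟩ := Fin.ext (by simp only; omega)
      rw [this]
    · intro y h1 h2
      have hy : (y - 1).toNat < n := by omega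
      refine ⟨(π.symm ⟨_, hy⟩ : ℤ) + 1, ⟨π.symm ⟨_, hy⟩, rfl, ?_⟩, ?_⟩
      · rw [π.apply_symm_apply]; simp only; omega
      · rintro x ⟨i, rfl, hi⟩
        have : π i = ⟨_, hy⟩ := Fin.ext (by simp only; omega)
        rw [← this, π.symm_apply_apply]
  · rintro ⟨hb, hc, hr⟩
    have hex : ∀ i : Fin n, ∃ j : Fin n, ((i : ℤ) + 1, (j : ℤ) + 1) ∈ S := by
      intro i
      obtain ⟨y, hy, -⟩ := hc ((i : ℤ) + 1) (by omega) (by omega)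
      have := hb _ _ hy
      refine ⟨⟨(y - 1).toNat, by omega⟩, ?_⟩
      rwa [show (((⟨(y - 1).toNat, by omega⟩ : Fin n) : ℕ) : ℤ) + 1 = y by simp only; omega]
    choose f hf using hex
    have hinj : Function.Injective f := by
      intro i j hij
      have h1 := hf i
      rw [hij] at h1
      have := (hr ((f j : ℤ) + 1) (by omega) (by omega)).unique h1 (hf j)
      exact Fin.ext (by omega)
    refine ⟨Equiv.ofBijective f (Finite.injective_iff_bijective.1 hinj), ?_⟩
    ext ⟨x, y⟩
    simp only [Set.mem_range, Prod.mk.injEq, Equiv.ofBijective_apply]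
    constructor
    · intro hxy
      have h1 := hb _ _ hxy
      have hx : ((x - 1).toNat : ℤ) + 1 = x := by omega
      have h2 := hf ⟨(x - 1).toNat, by omega⟩
      simp only [hx] at h2
      exact ⟨⟨(x - 1).toNat, by omega⟩, hx, (hc x h1.1 h1.2.1).unique h2 hxy⟩
    · rintro ⟨i, rfl, rfl⟩
      exact hf i

theorem IsConvexPermutomino.config {n : ℕ} {P : Finset (ℤ × ℤ)} (h : IsConvexPermutomino n P) :
    Config n (reentrantAt (cells P)) := by
  obtain ⟨-, hc, hr⟩ := (representsPerm_iff _ _).1 h.perm₁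
  simp only [mem_oddVertices_iff] at hc hr
  exact h.convexCells.config hc hr

theorem ConvexCells.isConvexPermutomino {n : ℕ} {P : Finset (ℤ × ℤ)}
    (h : ConvexCells n (cells P)) (hn : 2 ≤ n) (hc : Config n (reentrantAt (cells P))) :
    IsConvexPermutomino n P where
  polyomino := h.isPolyomino (by omega)
  noHoles := h.hasNoHoles
  columns := by
    ext x
    simp only [Finset.mem_image, Finset.mem_Icc]
    constructor
    · rintro ⟨⟨x, y⟩, hp, rfl⟩
      have := h.bound x y hp
      exact ⟨this.1, this.2.1⟩
    · rintro ⟨h1, h2⟩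
      obtain ⟨y, hy⟩ := h.col_nonempty x h1 h2
      exact ⟨(x, y), hy, rfl⟩
  rows := by
    ext y
    simp only [Finset.mem_image, Finset.mem_Icc]
    constructor
    · rintro ⟨⟨x, y⟩, hp, rfl⟩
      exact (h.bound x y hp).2.2
    · rintro ⟨h1, h2⟩
      obtain ⟨x, hx⟩ := h.row_nonempty y h1 h2
      exact ⟨(x, y), hx, rfl⟩
  perm₁ := by
    simp only [representsPerm_iff, mem_oddVertices_iff]
    exact ⟨fun x y => h.oddCorner_bound,
      fun x h1 h2 => (h.existsUnique_corner_col (by omega) hc h1 h2).1,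
      fun y h1 h2 => (h.existsUnique_corner_row (by omega) hc h1 h2).1⟩
  perm₂ := by
    simp only [representsPerm_iff, mem_evenVertices_iff]
    exact ⟨fun x y => h.evenCorner_bound,
      fun x h1 h2 => (h.existsUnique_corner_col (by omega) hc h1 h2).2,
      fun y h1 h2 => (h.existsUnique_corner_row (by omega) hc h1 h2).2⟩
  rowConvex := h.row
  columnConvex := h.col

/-- The labelled points of a matrix, with coordinates starting at `2`. -/
def pointsOf {m : ℕ} (M : SymbMatrix m) (t : Symb) (x y : ℤ) : Prop :=
  ∃ i j : Fin m, x = (i : ℤ) + 2 ∧ y = (j : ℤ) + 2 ∧ IsPoint M t i j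

theorem pointsOf_coe {m : ℕ} (M : SymbMatrix m) (t : Symb) (i j : Fin m) :
    pointsOf M t ((i : ℤ) + 2) ((j : ℤ) + 2) ↔ IsPoint M t i j := by
  constructor
  · rintro ⟨i', j', h1, h2, h3⟩
    obtain rfl : i = i' := Fin.ext (by omega)
    obtain rfl : j = j' := Fin.ext (by omega)
    exact h3
  · exact fun h => ⟨i, j, rfl, rfl, h⟩

theorem isReentrantMatrix_iff {m : ℕ} (P : Finset (ℤ × ℤ)) (M : SymbMatrix m) :
    IsReentrantMatrix P M ↔ reentrantAt (cells P) = pointsOf M := by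
  simp only [IsReentrantMatrix, Prod.forall, isReentrant_iff, Prod.mk.injEq, funext_iff, eq_iff_iff,
    pointsOf, and_assoc]

theorem pointsOf_injective {m : ℕ} :
    Function.Injective (pointsOf : SymbMatrix m → Symb → ℤ → ℤ → Prop) := by
  intro M M' h
  ext j i t
  have := pointsOf_coe M t i j
  rw [h, pointsOf_coe] at this
  exact this.symm

theorem Config.exists_matrix {m : ℕ} {T : Symb → ℤ → ℤ → Prop} (h : Config ((m : ℤ) + 2) T) :
    ∃ M : SymbMatrix m, pointsOf M = T := by
  classical
  refine ⟨fun j i => if hex : ∃ t, T t ((i : ℤ) + 2) ((j : ℤ) + 2) then some hex.choose else none,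
    ?_⟩
  have hM : ∀ t (i j : Fin m), (if hex : ∃ t, T t ((i : ℤ) + 2) ((j : ℤ) + 2) then
      some hex.choose else none) = some t ↔ T t ((i : ℤ) + 2) ((j : ℤ) + 2) := by
    intro t i j
    split_ifs with hex
    · rw [Option.some.injEq]
      constructor
      · rintro rfl; exact hex.choose_spec
      -- The chosen symbol is the right one, since a position carries at most one symbol.
      · exact fun ht => (h.unique_col _ _ _ _ _ hex.choose_spec ht).1
    · simpa using fun ht => hex ⟨t, ht⟩
  funext t x y
  refine propext ⟨?_, fun ht => ?_⟩
  · rintro ⟨i, j, rfl, rfl, hij⟩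
    exact (hM t i j).1 hij
  · have := h.bound t x y ht
    have hx : (((x - 2).toNat : ℕ) : ℤ) + 2 = x := by omega
    have hy : (((y - 2).toNat : ℕ) : ℤ) + 2 = y := by omega
    refine ⟨⟨(x - 2).toNat, by omega⟩, ⟨(y - 2).toNat, by omega⟩, hx.symm, hy.symm, ?_⟩
    refine (hM t _ _).2 ?_
    simp only [hx, hy]
    exact ht

theorem config_pointsOf_iff {m : ℕ} (M : SymbMatrix m) :
    Config ((m : ℤ) + 2) (pointsOf M) ↔ IsPermMatrix M ∧ OrderConditions M := by
  have hne : ∀ i j, M j i ≠ none ↔ ∃ t, IsPoint M t i j := fun i j => Option.ne_none_iff_exists'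
  constructor
  · intro h
    refine ⟨⟨fun j => ?_, fun i => ?_⟩, ?_⟩
    · obtain ⟨t, x, i, j', rfl, hj, hij⟩ := h.exists_row ((j : ℤ) + 2) (by omega) (by omega)
      obtain rfl : j = j' := Fin.ext (by omega)
      refine ⟨i, (hne i j).2 ⟨t, hij⟩, fun i' hi' => ?_⟩
      obtain ⟨t', ht'⟩ := (hne i' j).1 hi'
      have := (h.unique_row _ _ _ _ _ ((pointsOf_coe M t' i' j).2 ht')
        ((pointsOf_coe M t i j).2 hij)).2
      exact Fin.ext (by omega)
    · obtain ⟨t, y, i', j, hi, rfl, hij⟩ := h.exists_col ((i : ℤ) + 2) (by omega) (by omega)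
      obtain rfl : i = i' := Fin.ext (by omega)
      refine ⟨j, (hne i j).2 ⟨t, hij⟩, fun j' hj' => ?_⟩
      obtain ⟨t', ht'⟩ := (hne i j').1 hj'
      have := (h.unique_col _ _ _ _ _ ((pointsOf_coe M t' i j').2 ht')
        ((pointsOf_coe M t i j).2 hij)).2
      exact Fin.ext (by omega)
    · constructor <;> intro x y x' y' h1 h2 <;> rw [← pointsOf_coe] at h1 h2
      · have := h.αβ _ _ _ _ h1 h2; omega
      · have := h.δγ _ _ _ _ h1 h2; omega
      · have := h.αδ _ _ _ _ h1 h2; omega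
      · have := h.βγ _ _ _ _ h1 h2; omega
      · have := h.αγ _ _ _ _ h1 h2; omega
      · have := h.βδ _ _ _ _ h1 h2; omega
      · intro hlt; have := h.incr_α _ _ _ _ h1 h2 (by omega); omega
      · intro hlt; have := h.incr_γ _ _ _ _ h1 h2 (by omega); omega
      · intro hlt; have := h.decr_β _ _ _ _ h1 h2 (by omega); omega
      · intro hlt; have := h.decr_δ _ _ _ _ h1 h2 (by omega); omega
  · rintro ⟨⟨hr, hc⟩, ho⟩
    constructor
    · rintro t x y ⟨i, j, rfl, rfl, -⟩; omega
    · intro x h1 h2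
      obtain ⟨j, hj, -⟩ := hc ⟨(x - 2).toNat, by omega⟩
      obtain ⟨t, ht⟩ := (hne _ _).1 hj
      exact ⟨t, _, _, j, by simp only; omega, rfl, ht⟩
    · intro y h1 h2
      obtain ⟨i, hi, -⟩ := hr ⟨(y - 2).toNat, by omega⟩
      obtain ⟨t, ht⟩ := (hne _ _).1 hi
      exact ⟨t, _, i, _, rfl, by simp only; omega, ht⟩
    · rintro t t' x y y' ⟨i, j, rfl, rfl, h1⟩ ⟨i', j', hi, rfl, h2⟩
      obtain rfl : i = i' := Fin.ext (by omega)
      obtain rfl : j = j' := (hc i).unique ((hne i j).2 ⟨t, h1⟩) ((hne i j').2 ⟨t', h2⟩)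
      exact ⟨Option.some.inj (h1.symm.trans h2), rfl⟩
    · rintro t t' x x' y ⟨i, j, rfl, rfl, h1⟩ ⟨i', j', rfl, hj, h2⟩
      obtain rfl : j = j' := Fin.ext (by omega)
      obtain rfl : i = i' := (hr j).unique ((hne i j).2 ⟨t, h1⟩) ((hne i' j).2 ⟨t', h2⟩)
      exact ⟨Option.some.inj (h1.symm.trans h2), rfl⟩
    all_goals rintro _ _ _ _ ⟨i, j, rfl, rfl, h1⟩ ⟨i', j', rfl, rfl, h2⟩
    · have := ho.αβ _ _ _ _ h1 h2; omega
    · have := ho.δγ _ _ _ _ h1 h2; omega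
    · have := ho.αδ _ _ _ _ h1 h2; omega
    · have := ho.βγ _ _ _ _ h1 h2; omega
    · have := ho.αγ _ _ _ _ h1 h2; omega
    · have := ho.βδ _ _ _ _ h1 h2; omega
    · intro hlt; have := ho.incr_α _ _ _ _ h1 h2 (by omega); omega
    · intro hlt; have := ho.incr_γ _ _ _ _ h1 h2 (by omega); omega
    · intro hlt; have := ho.decr_β _ _ _ _ h1 h2 (by omega); omega
    · intro hlt; have := ho.decr_δ _ _ _ _ h1 h2 (by omega); omega

theorem exists_cells_eq_region (n : ℤ) (T : Symb → ℤ → ℤ → Prop) :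
    ∃ P : Finset (ℤ × ℤ), cells P = Region n T := by
  classical
  refine ⟨(Finset.Icc 1 (n - 1) ×ˢ Finset.Icc 1 (n - 1)).filter fun v => Region n T v.1 v.2, ?_⟩
  funext x y
  simp only [cells, Finset.mem_filter, Finset.mem_product, Finset.mem_Icc, eq_iff_iff,
    and_iff_right_iff_imp]
  intro h
  have := h.bound
  omega

theorem cells_injective : Function.Injective cells := by
  intro P P' h
  ext ⟨x, y⟩
  exact iff_of_eq (congrFun (congrFun h x) y)

end Permutomino

open Permutomino

theorem mainTheorem8 (n : ℕ) (hn : 2 ≤ n) :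
    (∀ P : Finset (ℤ × ℤ), Permutomino.IsConvexPermutomino n P →
      ∃! M : Permutomino.SymbMatrix (n - 2), Permutomino.IsReentrantMatrix P M) ∧
    (∀ (P : Finset (ℤ × ℤ)) (M : Permutomino.SymbMatrix (n - 2)),
      Permutomino.IsConvexPermutomino n P → Permutomino.IsReentrantMatrix P M →
        Permutomino.IsPermMatrix M ∧ Permutomino.OrderConditions M) ∧
    (∀ M : Permutomino.SymbMatrix (n - 2),
      Permutomino.IsPermMatrix M → Permutomino.OrderConditions M →
        ∃! P : Finset (ℤ × ℤ),
          Permutomino.IsConvexPermutomino n P ∧ Permutomino.IsReentrantMatrix P M) := by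
  have hn' : ((n - 2 : ℕ) : ℤ) + 2 = n := by omega
  simp only [isReentrantMatrix_iff]
  refine ⟨fun P hP => ?_, fun P M hP hM => ?_, fun M h1 h2 => ?_⟩
  · obtain ⟨M, hM⟩ := Config.exists_matrix (m := n - 2) (by rw [hn']; exact hP.config)
    exact ⟨M, hM.symm, fun M' hM' => pointsOf_injective (hM'.symm.trans hM.symm)⟩
  · rw [← config_pointsOf_iff, hn', ← hM]
    exact hP.config
  · have hc : Config n (pointsOf M) := by
      rw [← hn']
      exact (config_pointsOf_iff M).2 ⟨h1, h2⟩
    obtain ⟨P, hP⟩ := exists_cells_eq_region n (pointsOf M)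
    have hPM : reentrantAt (cells P) = pointsOf M := by rw [hP, hc.reentrantAt_region]
    refine ⟨P, ⟨?_, hPM⟩, ?_⟩
    · refine ConvexCells.isConvexPermutomino ?_ hn (by rwa [hPM])
      rw [hP]
      exact hc.convexCells
    · rintro P' ⟨hP', hPM'⟩
      -- Any competitor is the region of its own reentrant points, which are the points of `M`.
      refine cells_injective (hP.symm ▸ ?_)
      funext x y
      rw [← hPM']
      exact propext (hP'.convexCells.iff_region x y)
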